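/- **Setting.** Fix $T>0$, $\mu,\sigma\in\mathbb R$, $a<b$. For $d\ge 1$ let $f:[0,T]\times\mathbb R^d\times\mathbb R\times\mathbb R^d\to\mathbb R$, $g:\mathbb R^d\to\mathbb R$ and $C_f,C_g>0$ satisfy $|f(t_1,x_1,y_1,z_1)-f(t_2,x_2,y_2,z_2)|\le C_f(|t_1-t_2|^{1/2}+\|x_1-x_2\|_2+|y_1-y_2|+\|z_1-z_2\|_2)$ and $|g(x_1)-g(x_2)|\le C_g\|x_1-x_2\|_2$, and put $C_{fg}=\max\{C_f^2,C_g^2,f(0,0,0,0)^2,g(0)^2\}$. Let $0=t_0<\dots<t_N=T$ be a grid, $0\le i<N$, and $\Delta t_i=t_{i+1}-t_i$ with $C_f\Delta t_i<1$. Let $X$ be the solution, started at $\eta$ uniform on $[a,b]^d$, of $dX_t=\mu\mathbf 1_d\,dt+\sigma\,dB_t$ (heat case) or of $dX_t=\mu X_t\,dt+\sigma\,\mathrm{diag}(X_t)\,dB_t$ (Black–Scholes case). With a standard Gaussian $W$ on $\mathbb R^{3d}$ and the standard normal distribution function $\Phi$, write $\eta=a+(b-a)\Phi(W_{1:d})$,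 $B_{t_i}=\sqrt{t_i}\,W_{d+1:2d}$, $\Delta B_i=\sqrt{\Delta t_i}\,W_{2d+1:3d}$, so that $X_{t_i}$ and $X_{t_{i+1}}$ are explicit functions of $W$. For functions $\hat u,u:\mathbb R^d\to\mathbb R$ and $z:\mathbb R^d\to\mathbb R^d$ let $$G^{\hat u}(W;u,z)=\bigl|\hat u(X_{t_{i+1}})-u(X_{t_i})+f(t_i,X_{t_i},u(X_{t_i}),z(X_{t_i}))\Delta t_i-z(X_{t_i})^{\top}\Delta B_i\bigr|^2,\qquad L(\hat u,u,z)=\mathbb E\,G^{\hat u}(W;u,z).$$ $\mathcal N_{S,R}$ is the class of feedforward $\tanh$ networks with layer sizes $S$ and all weights and biases bounded by $R$ in absolute value; $D(S)$ is the number of affine layers and $\|S\|_\infty$ the largest layer size. For a list of hidden widths $(l_2,\dots,l_k)$, possibly empty, put $S_1=(d,l_2,\dots,l_k,1)$ and $S_2=(d,l_2,\dots,l_k,d)$, and let $\mathcal U(\cdot;\theta)\in\mathcal N_{S_1,R}$, $\mathcal Z(\cdot;\theta)\in\mathcal N_{S_2,R}$, where $\theta$ is the vector of all parameters of the two networks and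 ranges over $\Theta=\{\|\theta\|_\infty\le R\}$. **Approximation assumption** (with a polynomial $p$ in two variables). For every $\varepsilon>0$ there are given hidden widths and a bound $R$ (which determine $S_1,S_2,R,\Theta$ at level $\varepsilon$), a function $\hat u$, and a minimizer $(\mathcal U^*,\mathcal Z^*)$ of $L(\hat u,\cdot,\cdot)$ over all pairs $(u,z)$ of measurable functions with $\mathbb E|u(X_{t_i})|^2+\mathbb E\|z(X_{t_i})\|_2^2<\infty$, all of which may depend on $\varepsilon$, such that: $\hat u=g$ if $i=N-1$, while if $i<N-1$, $\hat u\in\mathcal N_{S',R'}$ for some $R'$ and some $S'=(d,l_2',\dots,l_{k'}',1)$ with $\max\{R',D(S'),\|S'\|_\infty\}\le p(d,\varepsilon^{-1})$; $\max\{R,D(S_1),\|S_1\|_\infty\}\le p(d,\varepsilon^{-1})$; and for some $\theta\in\Theta$ $$\mathbb E|\mathcal U^*(X_{t_i})-\mathcal U(X_{t_i};\theta)|^2+\mathbb E\|\mathcal Z^*(X_{t_i})-\mathcal Z(X_{t_i};\theta)\|_2^2\le\varepsilon .$$ **Theorem.** For all $T,\mu,\sigma,a,b$ and every polynomial $p$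 there is a polynomial $h$ in three variables, depending on nothing else, such that the following holds in both cases, for all $d,f,g,C_f,C_g$, grids and $i$ as above. If the approximation assumption holds with $p$, then for every $\delta>0$ there is a level $\varepsilon>0$ whose networks satisfy $\max\{R,D(S_1),\|S_1\|_\infty\}\le h(\delta^{-1},d,C_{fg})$ and such that, with $\hat u,\mathcal U^*,\mathcal Z^*,\Theta$ of this level, $\mathcal L(\theta)=L(\hat u,\mathcal U(\cdot;\theta),\mathcal Z(\cdot;\theta))$ and $\mathcal L^*=L(\hat u,\mathcal U^*,\mathcal Z^*)$: for every $m\ge h(\delta^{-1},d,C_{fg})$, all independent standard Gaussian samples $w_1,\dots,w_m$ in $\mathbb R^{3d}$ and every random variable $\theta^{(m)}$ that minimizes the empirical risk $\frac1m\sum_{j=1}^m G^{\hat u}(w_j;\mathcal U(\cdot;\theta),\mathcal Z(\cdot;\theta))$ over $\theta\in\Theta$, the random variable $\mathcal L(\theta^{(m)})$ is integrable and $$\mathbb E\bigl[\mathcal L(\theta^{(m)})-\mathcal L^*\bigr]\le\delta .$$ -/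

import Mathlib

open MeasureTheory ProbabilityTheory

noncomputable section

namespace DBDP

/-! ### Feedforward tanh networks -/

/-- Index type of the weights and biases of a network with structure `(a, H, b)`, where `a` is the
input dimension, `H` the list of the widths of the hidden layers and `b` the output dimension.
Each layer from width `l` to width `l'` contributes the entries of an `l' × l` weight matrix
and the `l'` entries of a bias vector. -/
def ParamIdx : ℕ → List ℕ → ℕ → Type
  | a, [], b => (Fin b × Fin a) ⊕ Fin b
  | a, c :: H, b => ((Fin c × Fin a) ⊕ Fin c) ⊕ ParamIdx c H b

/-- There are finitely many parameters. -/
instance instFintypeParamIdx : (a : ℕ) → (H : List ℕ) → (b : ℕ) → Fintype (ParamIdx a H b)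
  | a, [], b => inferInstanceAs (Fintype ((Fin b × Fin a) ⊕ Fin b))
  | a, c :: H, b =>
    letI := instFintypeParamIdx c H b
    inferInstanceAs (Fintype (((Fin c × Fin a) ⊕ Fin c) ⊕ ParamIdx c H b))

/-- Parameter vectors of networks with structure `(a, H, b)`; as a finite product of copies of `ℝ`
this space carries the sup norm `‖θ‖_∞` and the Borel sigma-algebra. -/
abbrev Params (a : ℕ) (H : List ℕ) (b : ℕ) : Type := ParamIdx a H b → ℝ

/-- The network `A_k ∘ tanh ∘ A_{k-1} ∘ ⋯ ∘ tanh ∘ A_1` with `A_j x = Q_j x + b_j`. -/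
def network : (a : ℕ) → (H : List ℕ) → (b : ℕ) → Params a H b → (Fin a → ℝ) → (Fin b → ℝ)
  | _, [], _, θ, x => fun j => ∑ k, θ (Sum.inl (j, k)) * x k + θ (Sum.inr j)
  | _, c :: H, b, θ, x =>
    network c H b (fun q => θ (Sum.inr q))
      (fun j => Real.tanh
        (∑ k, θ (Sum.inl (Sum.inl (j, k))) * x k + θ (Sum.inl (Sum.inr j))))

/-- The depth `D(S)` of `S = (a, H, b)`: the number of affine maps. -/
def depth (H : List ℕ) : ℕ := H.length + 1

/-- The width `‖S‖_∞` of `S = (a, H, b)`: the largest layer size, input and output included. -/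
def width (a : ℕ) (H : List ℕ) (b : ℕ) : ℕ := (a :: (H ++ [b])).foldr max 0

/-- `max {R, D(S₁), ‖S₁‖_∞}` for `S₁ = (d, H, 1)`. -/
def netSize (d : ℕ) (H : List ℕ) (R : ℝ) : ℝ :=
  max R (max (depth H : ℝ) (width d H 1 : ℝ))

/-- A parameter of the pair of networks: one network with structure `S₁ = (d, H, 1)` and one with
structure `S₂ = (d, H, d)`. -/
abbrev PairParams (d : ℕ) (H : List ℕ) : Type := Params d H 1 × Params d H d

/-- The parameter set `Θ = {θ : ‖θ‖_∞ ≤ R}`. -/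
def paramSet (d : ℕ) (H : List ℕ) (R : ℝ) : Set (PairParams d H) := {θ | ‖θ‖ ≤ R}

/-- The real-valued network with structure `S₁ = (d, H, 1)`. -/
def netU {d : ℕ} {H : List ℕ} (ϑ : Params d H 1) (x : Fin d → ℝ) : ℝ := network d H 1 ϑ x 0

/-- The `ℝ^d`-valued network with structure `S₂ = (d, H, d)`. -/
def netZ {d : ℕ} {H : List ℕ} (ϑ : Params d H d) (x : Fin d → ℝ) : Fin d → ℝ := network d H d ϑ x

/-- The class `N_{S₁,R}` of real-valued networks with parameters bounded by `R`. -/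
def netClass (d : ℕ) (H : List ℕ) (R : ℝ) : Set ((Fin d → ℝ) → ℝ) :=
  {u | ∃ ϑ : Params d H 1, ‖ϑ‖ ≤ R ∧ u = netU ϑ}

/-! ### The data of the equation and the simulation of the forward process -/

/-- The Euclidean norm on `ℝ^d` (the norm that `Fin d → ℝ` carries in Mathlib is the sup norm). -/
def norm2 {d : ℕ} (x : Fin d → ℝ) : ℝ := √(∑ k, x k ^ 2)

/-- The two types of forward equation: `dX = μ dt + σ dW`, and
`dX = diag(X) μ dt + diag(X) σ dW`, in both cases with drift vector `μ 1_d` and volatility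
matrix `σ I_d`. -/
inductive EquationType
  | heat
  | blackScholes

/-- Time horizon `T > 0`, coefficients `μ, σ` and the region `[a, b]^d` of the initial value. -/
structure ModelParams where
  T : ℝ
  μ : ℝ
  σ : ℝ
  a : ℝ
  b : ℝ
  T_pos : 0 < T
  a_lt_b : a < b

/-- The nonlinearity `f` and the terminal function `g`, with their Lipschitz constants. -/
structure PDEData (T : ℝ) (d : ℕ) where
  f : ℝ → (Fin d → ℝ) → ℝ → (Fin d → ℝ) → ℝ
  g : (Fin d → ℝ) → ℝ
  Cf : ℝ
  Cg : ℝ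
  Cf_pos : 0 < Cf
  Cg_pos : 0 < Cg
  f_lip : ∀ t₁ ∈ Set.Icc 0 T, ∀ t₂ ∈ Set.Icc 0 T, ∀ x₁ x₂ y₁ y₂ z₁ z₂,
    |f t₁ x₁ y₁ z₁ - f t₂ x₂ y₂ z₂| ≤
      Cf * (√|t₁ - t₂| + norm2 (x₁ - x₂) + |y₁ - y₂| + norm2 (z₁ - z₂))
  g_lip : ∀ x₁ x₂, |g x₁ - g x₂| ≤ Cg * norm2 (x₁ - x₂)

/-- `C_{fg} = max {C_f², C_g², f(0)², g(0)²}`. -/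
def PDEData.Cfg {T : ℝ} {d : ℕ} (D : PDEData T d) : ℝ :=
  max (D.Cf ^ 2) (max (D.Cg ^ 2) (max (D.f 0 0 0 0 ^ 2) (D.g 0 ^ 2)))

/-- A time grid `0 = t_0 < t_1 < ⋯ < t_N = T`. -/
structure TimeGrid (T : ℝ) where
  N : ℕ
  t : Fin (N + 1) → ℝ
  t_zero : t 0 = 0
  t_last : t (Fin.last N) = T
  strictMono : StrictMono t

/-- The grid point `t_i`, for `0 ≤ i ≤ N - 1`. -/
def TimeGrid.time {T : ℝ} (G : TimeGrid T) (i : Fin G.N) : ℝ := G.t i.castSucc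

/-- The step `Δt_i = t_{i+1} - t_i`. -/
def TimeGrid.step {T : ℝ} (G : TimeGrid T) (i : Fin G.N) : ℝ := G.t i.succ - G.t i.castSucc

/-- The space `ℝ^{3d}` of samples, written as three blocks of length `d`. -/
abbrev Sample (d : ℕ) : Type := Fin 3 → Fin d → ℝ

/-- The standard Gaussian measure on `ℝ^{3d}`. -/
def sampleLaw (d : ℕ) : Measure (Sample d) :=
  Measure.pi fun _ => Measure.pi fun _ => gaussianReal 0 1

/-- The initial value `η = (b - a) Φ(w_{1:d}) + a`, uniformly distributed on `[a, b]^d`;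
`Φ` is the standard normal distribution function. -/
def initial (P : ModelParams) {d : ℕ} (w : Sample d) : Fin d → ℝ :=
  fun k => (P.b - P.a) * cdf (gaussianReal 0 1) (w 0 k) + P.a

/-- The value `W_t = √t w_{(d+1):2d}` of the Brownian motion. -/
def brownian {d : ℕ} (t : ℝ) (w : Sample d) : Fin d → ℝ := fun k => √t * w 1 k

/-- The increment `ΔW = √Δ w_{(2d+1):3d}` of the Brownian motion over a step `Δ`. -/
def increment {d : ℕ} (Δ : ℝ) (w : Sample d) : Fin d → ℝ := fun k => √Δ * w 2 k

/-- The exact solution `X_t` of the forward equation. -/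
def state (e : EquationType) (P : ModelParams) {d : ℕ} (t : ℝ) (w : Sample d) : Fin d → ℝ :=
  fun k => match e with
    | .heat => initial P w k + P.μ * t + P.σ * brownian t w k
    | .blackScholes =>
      initial P w k * Real.exp ((P.μ - P.σ ^ 2 / 2) * t + P.σ * brownian t w k)

/-- The exact solution `X_{t + Δ}` of the forward equation. -/
def nextState (e : EquationType) (P : ModelParams) {d : ℕ} (t Δ : ℝ) (w : Sample d) : Fin d → ℝ :=
  fun k => match e with
    | .heat => state e P t w k + P.μ * Δ + P.σ * increment Δ w k
    | .blackScholes =>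
      state e P t w k * Real.exp ((P.μ - P.σ ^ 2 / 2) * Δ + P.σ * increment Δ w k)

/-! ### One step of the backward scheme

The arguments are: the type of equation, the model parameters, the data `(f, g)`, the grid and the
index `i` of the time step. -/

section Step

variable (e : EquationType) (P : ModelParams) {d : ℕ} (D : PDEData P.T d) (G : TimeGrid P.T)
  (i : Fin G.N)

/-- `F(t, x, y, z, h, Δ) = y - f(t, x, y, z) h + zᵀ Δ`. -/
def driverF (t : ℝ) (x : Fin d → ℝ) (y : ℝ) (z : Fin d → ℝ) (h : ℝ) (Δ : Fin d → ℝ) : ℝ :=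
  y - D.f t x y z * h + ∑ k, z k * Δ k

/-- The integrand
`|Û(X_{t_{i+1}}) - F(t_i, X_{t_i}, u(X_{t_i}), z(X_{t_i}), Δt_i, ΔW_{t_i})|²` as a function of
the Gaussian sample. -/
def pointLoss (uNext u : (Fin d → ℝ) → ℝ) (z : (Fin d → ℝ) → Fin d → ℝ) (w : Sample d) : ℝ :=
  let X := state e P (G.time i) w
  (uNext (nextState e P (G.time i) (G.step i) w)
    - driverF P D (G.time i) X (u X) (z X) (G.step i) (increment (G.step i) w)) ^ 2

/-- `L_i(Û, u, z)`, the expectation of the integrand. -/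
def loss (uNext u : (Fin d → ℝ) → ℝ) (z : (Fin d → ℝ) → Fin d → ℝ) : ℝ :=
  ∫ w, pointLoss e P D G i uNext u z w ∂(sampleLaw d)

/-- The risk `θ ↦ L_i(Û, U(·; θ), Z(·; θ))`. -/
def risk {H : List ℕ} (uNext : (Fin d → ℝ) → ℝ) (θ : PairParams d H) : ℝ :=
  loss e P D G i uNext (netU θ.1) (netZ θ.2)

/-- The empirical risk of `θ` for the sample `w_1, …, w_m`. -/
def empiricalRisk {H : List ℕ} (uNext : (Fin d → ℝ) → ℝ) {m : ℕ} (w : Fin m → Sample d)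
    (θ : PairParams d H) : ℝ :=
  (1 / (m : ℝ)) * ∑ j, pointLoss e P D G i uNext (netU θ.1) (netZ θ.2) (w j)

/-- Pairs of measurable functions with `E|u(X_{t_i})|² < ∞` and `E|z(X_{t_i})|² < ∞`. -/
def Admissible (u : (Fin d → ℝ) → ℝ) (z : (Fin d → ℝ) → Fin d → ℝ) : Prop :=
  Measurable u ∧ Measurable z ∧
  Integrable (fun w => u (state e P (G.time i) w) ^ 2) (sampleLaw d) ∧
  Integrable (fun w => norm2 (z (state e P (G.time i) w)) ^ 2) (sampleLaw d)

/-- `(u, z)` minimizes `L_i(Û, ·, ·)` over all admissible pairs of functions. -/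
def IsOptimalPair (uNext u : (Fin d → ℝ) → ℝ) (z : (Fin d → ℝ) → Fin d → ℝ) : Prop :=
  Admissible e P G i u z ∧
  ∀ u' z', Admissible e P G i u' z' → loss e P D G i uNext u z ≤ loss e P D G i uNext u' z'

/-- `E|u(X_{t_i}) - u'(X_{t_i})|² + E|z(X_{t_i}) - z'(X_{t_i})|²`. -/
def approxError (u u' : (Fin d → ℝ) → ℝ) (z z' : (Fin d → ℝ) → Fin d → ℝ) : ℝ :=
  ∫ w, (u (state e P (G.time i) w) - u' (state e P (G.time i) w)) ^ 2 ∂(sampleLaw d) +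
  ∫ w, norm2 (z (state e P (G.time i) w) - z' (state e P (G.time i) w)) ^ 2 ∂(sampleLaw d)

/-- What the scheme passes to step `i` at accuracy `ε`: the function `Û_{i+1}` is `g` if
`i + 1 = N`, and otherwise a network of size at most `p(d, ε⁻¹)`. -/
def IsNextStage (p : MvPolynomial (Fin 2) ℝ) (ε : ℝ) (uNext : (Fin d → ℝ) → ℝ) : Prop :=
  ((i : ℕ) + 1 = G.N → uNext = D.g) ∧
  ((i : ℕ) + 1 < G.N → ∃ (H : List ℕ) (R : ℝ),
    netSize d H R ≤ MvPolynomial.eval ![(d : ℝ), ε⁻¹] p ∧ uNext ∈ netClass d H R)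

/-- The approximation assumption with polynomial `p`. For every accuracy `ε > 0`, the hidden widths
`H ε` and the parameter bound `R ε` have size at most `p(d, ε⁻¹)`, and some pair of networks with
this structure and this parameter bound approximates the optimal pair `(uOpt ε, zOpt ε)`
belonging to the function `uNext ε` up to `ε`. -/
def ApproxAssumption (p : MvPolynomial (Fin 2) ℝ) (H : ℝ → List ℕ) (R : ℝ → ℝ)
    (uNext uOpt : ℝ → (Fin d → ℝ) → ℝ) (zOpt : ℝ → (Fin d → ℝ) → Fin d → ℝ) : Prop :=
  ∀ ε : ℝ, 0 < ε →
    IsNextStage P D G i p ε (uNext ε) ∧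
    IsOptimalPair e P D G i (uNext ε) (uOpt ε) (zOpt ε) ∧
    netSize d (H ε) (R ε) ≤ MvPolynomial.eval ![(d : ℝ), ε⁻¹] p ∧
    ∃ θ ∈ paramSet d (H ε) (R ε),
      approxError e P G i (uOpt ε) (netU θ.1) (zOpt ε) (netZ θ.2) ≤ ε

end Step

end DBDP

end

namespace DBDP

/-! ### Bounds for tanh networks -/

/-! The excess risk splits into an approximation error, the loss at a well-approximating parameter
θ₀ minus the optimal loss, and the statistical error of the empirical minimizer relative to θ₀. Each
receives δ/2.

Approximation: the residual inside L need not be affine in (u, z), because f may be nonlinear. Since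
C_f Δt_i < 1, the substitution v = u - f(t_i, ·, u, z) Δt_i can be inverted in u by Banach's fixed
point theorem, and both directions preserve measurability and square integrability
(`PDEData.exists_implicitPart_eq`, `admissible_of_implicitPart`). In the coordinates (v, z) the
residual is affine, so the optimal residual is orthogonal to all perturbations, and by Pythagoras
the excess loss is the second moment of the perturbation (`loss_eq_loss_optimal_add`). Independence
of X_{t_i} and the increment bounds it by 3(5 + Td) times the approximation error
(`loss_sub_loss_optimal_le`), hence the level ε = δ / (6(5 + Td)).

Statistics: the integrand is unbounded, but over Θ it is dominated by M²ρ⁴, where ρ has an eighth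
moment of order d⁸. Truncation at a level K then costs M⁴ E ρ⁸ / K. The truncated integrands are
compared with those of a finite net of parameters, where Hoeffding's lemma and a union bound through
exponential moments give log |N| / λ + λK² / (8m) (`integral_risk_minimizer_le`).

Polynomial size: since tanh is bounded, networks grow at most linearly in the input, with a constant
that is free of the depth (`abs_network_le`). Their Lipschitz constant in the parameters
(`abs_network_sub_le`) is exponential in the depth, but it enters only through the logarithm of the
covering number (`log_net_card_le`). All remaining constants are polynomial in δ⁻¹, d and C_{fg}. -/

lemma abs_tanh_le_one (x : ℝ) : |Real.tanh x| ≤ 1 :=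
  abs_le.2 ⟨(Real.neg_one_lt_tanh x).le, (Real.tanh_lt_one x).le⟩

lemma hasDerivAt_tanh (x : ℝ) : HasDerivAt Real.tanh (1 / Real.cosh x ^ 2) x := by
  have h := (Real.hasDerivAt_sinh x).div (Real.hasDerivAt_cosh x) (Real.cosh_pos x).ne'
  have e : (Real.sinh / Real.cosh) = Real.tanh := by
    funext y
    simp [Real.tanh_eq_sinh_div_cosh]
  rw [e] at h
  refine h.congr_deriv ?_
  congr 1
  linarith [Real.cosh_sq x]

lemma lipschitzWith_tanh : LipschitzWith 1 Real.tanh := by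
  refine lipschitzWith_of_nnnorm_deriv_le (fun x => (hasDerivAt_tanh x).differentiableAt) ?_
  intro x
  rw [(hasDerivAt_tanh x).deriv, ← NNReal.coe_le_coe, coe_nnnorm, Real.norm_of_nonneg (by positivity)]
  have := Real.one_le_cosh x
  rw [NNReal.coe_one, div_le_one (by positivity)]
  nlinarith

lemma abs_tanh_sub_le (x y : ℝ) : |Real.tanh x - Real.tanh y| ≤ |x - y| := by
  simpa [Real.dist_eq] using lipschitzWith_tanh.dist_le_mul x y

/-- The `ℓ¹`-norm on `ℝ^d`. -/
def norm1 {d : ℕ} (x : Fin d → ℝ) : ℝ := ∑ k, |x k|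

lemma norm1_nonneg {d : ℕ} (x : Fin d → ℝ) : 0 ≤ norm1 x :=
  Finset.sum_nonneg fun _ _ => abs_nonneg _

lemma norm1_le_of_abs_le {d : ℕ} {x : Fin d → ℝ} {C : ℝ} (h : ∀ k, |x k| ≤ C) :
    norm1 x ≤ d * C := by
  simpa [norm1] using Finset.sum_le_card_nsmul Finset.univ (fun k => |x k|) C (fun k _ => h k)

lemma abs_affine_le {a : ℕ} (q x : Fin a → ℝ) (β S : ℝ) (hq : ∀ k, |q k| ≤ S) (hβ : |β| ≤ S) :
    |∑ k, q k * x k + β| ≤ S * (norm1 x + 1) := by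
  have h : |∑ k, q k * x k| ≤ S * norm1 x := by
    refine (Finset.abs_sum_le_sum_abs _ _).trans ?_
    rw [norm1, Finset.mul_sum]
    refine Finset.sum_le_sum fun k _ => ?_
    rw [abs_mul]
    exact mul_le_mul_of_nonneg_right (hq k) (abs_nonneg _)
  linarith [abs_add_le (∑ k, q k * x k) β]

/-- Writing q x - q' x' = q (x - x') + (q - q') x' puts the size bound on one parameter only; the
primed one may be arbitrary. -/
lemma abs_affine_sub_le {a : ℕ} (q q' x x' : Fin a → ℝ) (β β' S η : ℝ)
    (hq : ∀ k, |q k| ≤ S) (hqq : ∀ k, |q k - q' k| ≤ η) (hβ : |β - β'| ≤ η) :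
    |(∑ k, q k * x k + β) - (∑ k, q' k * x' k + β')|
      ≤ S * norm1 (x - x') + η * (norm1 x' + 1) := by
  have e : (∑ k, q k * x k + β) - (∑ k, q' k * x' k + β')
      = ∑ k, q k * (x - x') k + (∑ k, (q k - q' k) * x' k + (β - β')) := by
    have : ∑ k, q k * x k = ∑ k, q k * (x - x') k + ∑ k, (q k - q' k) * x' k
        + ∑ k, q' k * x' k := by
      rw [← Finset.sum_add_distrib, ← Finset.sum_add_distrib]
      refine Finset.sum_congr rfl fun k _ => ?_
      simp only [Pi.sub_apply]
      ring
    rw [this]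
    ring
  rw [e]
  refine (abs_add_le _ _).trans (add_le_add ?_ (abs_affine_le _ _ _ _ hqq hβ))
  refine (Finset.abs_sum_le_sum_abs _ _).trans ?_
  rw [norm1, Finset.mul_sum]
  refine Finset.sum_le_sum fun k _ => ?_
  rw [abs_mul]
  exact mul_le_mul_of_nonneg_right (hq k) (abs_nonneg _)

/-- All layer sizes are at most `S`. -/
def SizesLe (a : ℕ) (H : List ℕ) (b : ℕ) (S : ℝ) : Prop :=
  (a : ℝ) ≤ S ∧ (b : ℝ) ≤ S ∧ ∀ c ∈ H, (c : ℝ) ≤ S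

lemma SizesLe.tail {a c : ℕ} {H : List ℕ} {b : ℕ} {S : ℝ} (h : SizesLe a (c :: H) b S) :
    SizesLe c H b S :=
  ⟨h.2.2 c (by simp), h.2.1, fun e he => h.2.2 e (by simp [he])⟩

lemma norm_param_tail_le {a c : ℕ} {H : List ℕ} {b : ℕ} (θ : Params a (c :: H) b) :
    ‖(fun q => θ (Sum.inr q) : Params c H b)‖ ≤ ‖θ‖ :=
  (pi_norm_le_iff_of_nonneg (norm_nonneg _)).2 fun q => norm_le_pi_norm θ (Sum.inr q)

/-- After a tanh layer the ℓ¹-norm is at most the width, hence at most S. Only the last affine map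
contributes to the growth, so no power of the depth appears; the maximum with S makes the induction
close. -/
lemma abs_network_le' {S : ℝ} (hS : 0 ≤ S) : ∀ (a : ℕ) (H : List ℕ) (b : ℕ) (_ : SizesLe a H b S)
    (θ : Params a H b) (_ : ‖θ‖ ≤ S) (x : Fin a → ℝ) (j : Fin b),
    |network a H b θ x j| ≤ S * (max (norm1 x) S + 1)
  | a, [], b, hs, θ, hθ, x, j => by
    refine (abs_affine_le _ x _ S (fun k => (norm_le_pi_norm θ _).trans hθ)
      ((norm_le_pi_norm θ _).trans hθ)).trans ?_
    gcongr
    exact le_max_left _ _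
  | a, c :: H, b, hs, θ, hθ, x, j => by
    refine (abs_network_le' hS c H b hs.tail _ ((norm_param_tail_le θ).trans hθ) _ j).trans ?_
    refine mul_le_mul_of_nonneg_left (add_le_add ?_ le_rfl) hS
    refine (max_le ?_ le_rfl).trans (le_max_right (norm1 x) S)
    refine (norm1_le_of_abs_le (C := 1) fun k => abs_tanh_le_one _).trans ?_
    simpa using hs.2.2 c (by simp)

lemma abs_network_le {S : ℝ} (hS : 1 ≤ S) {a : ℕ} {H : List ℕ} {b : ℕ} (hs : SizesLe a H b S)
    {θ : Params a H b} (hθ : ‖θ‖ ≤ S) (x : Fin a → ℝ) (j : Fin b) :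
    |network a H b θ x j| ≤ 2 * S ^ 2 * (norm1 x + 1) := by
  have h := abs_network_le' (zero_le_one.trans hS) a H b hs θ hθ x j
  have hn := norm1_nonneg x
  have hm : max (norm1 x) S ≤ norm1 x + S := max_le (by linarith) (by linarith)
  have : S * (max (norm1 x) S + 1) ≤ S * (norm1 x + S + 1) := by gcongr
  nlinarith [mul_nonneg hn (sub_nonneg.2 hS), mul_nonneg hn (sq_nonneg S),
    mul_nonneg (mul_nonneg hn (sub_nonneg.2 hS)) (zero_le_one.trans hS)]

/-- Each hidden layer multiplies the joint error in input and parameters by at most 3S²: one factor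
S is the weight bound and one the width, over which the ℓ¹-norm sums. The hidden values have ℓ¹-norm
at most S, so the parameter error of the later layers is at most 2S times the original one. -/
lemma abs_network_sub_le {S : ℝ} (hS : 1 ≤ S) : ∀ (a : ℕ) (H : List ℕ) (b : ℕ)
    (_ : SizesLe a H b S) (θ θ' : Params a H b) (_ : ‖θ‖ ≤ S) (x x' : Fin a → ℝ) (j : Fin b),
    |network a H b θ x j - network a H b θ' x' j|
      ≤ (S * (3 * S ^ 2) ^ H.length) * (norm1 (x - x') + ‖θ - θ'‖ * (norm1 x' + 1))
  | a, [], b, hs, θ, θ', hθ, x, x', j => by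
    refine (abs_affine_sub_le (fun k => θ (Sum.inl (j, k))) (fun k => θ' (Sum.inl (j, k))) x x'
      _ _ S ‖θ - θ'‖ (fun k => (norm_le_pi_norm θ _).trans hθ)
      (fun k => norm_le_pi_norm (θ - θ') _) (norm_le_pi_norm (θ - θ') (Sum.inr j))).trans ?_
    have := norm1_nonneg x'
    have h2 : 0 ≤ ‖θ - θ'‖ * (norm1 x' + 1) := by positivity
    simp only [List.length_nil, pow_zero, mul_one]
    nlinarith
  | a, c :: H, b, hs, θ, θ', hθ, x, x', j => by
    have hS0 : 0 ≤ S := zero_le_one.trans hS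
    have hc : (c : ℝ) ≤ S := hs.2.2 c (by simp)
    set η := ‖θ - θ'‖ with hη
    have hη0 : 0 ≤ η := norm_nonneg _
    have hx := norm1_nonneg (x - x')
    have hx' := norm1_nonneg x'
    refine (abs_network_sub_le hS c H b hs.tail _ (fun q => θ' (Sum.inr q))
      ((norm_param_tail_le θ).trans hθ) _
      (fun j => Real.tanh (∑ k, θ' (Sum.inl (Sum.inl (j, k))) * x' k
        + θ' (Sum.inl (Sum.inr j)))) j).trans ?_
    have h1 : ‖(fun q => θ (Sum.inr q) : Params c H b) - (fun q => θ' (Sum.inr q))‖ ≤ η :=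
      norm_param_tail_le (θ - θ')
    have h2 := norm1_le_of_abs_le (x := fun j => Real.tanh
      (∑ k, θ' (Sum.inl (Sum.inl (j, k))) * x' k + θ' (Sum.inl (Sum.inr j)))) (C := 1)
      (fun k => abs_tanh_le_one _)
    have h3 := norm1_le_of_abs_le (x := (fun j => Real.tanh
      (∑ k, θ (Sum.inl (Sum.inl (j, k))) * x k + θ (Sum.inl (Sum.inr j)))) - (fun j => Real.tanh
      (∑ k, θ' (Sum.inl (Sum.inl (j, k))) * x' k + θ' (Sum.inl (Sum.inr j)))))
      (C := S * norm1 (x - x') + η * (norm1 x' + 1)) (fun j => (abs_tanh_sub_le _ _).trans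
        (abs_affine_sub_le (fun k => θ (Sum.inl (Sum.inl (j, k)))) _ x x' _ _ S η
        (fun k => (norm_le_pi_norm θ _).trans hθ)
        (fun k => norm_le_pi_norm (θ - θ') (Sum.inl (Sum.inl (j, k))))
        (norm_le_pi_norm (θ - θ') (Sum.inl (Sum.inr j)))))
    have h4 : (c : ℝ) * (S * norm1 (x - x') + η * (norm1 x' + 1))
        ≤ S * (S * norm1 (x - x') + η * (norm1 x' + 1)) := by gcongr
    have h5 : (3 * S ^ 2) ^ (H.length + 1) = (3 * S ^ 2) ^ H.length * (3 * S ^ 2) := pow_succ _ _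
    rw [List.length_cons, h5, ← mul_assoc, mul_assoc (S * (3 * S ^ 2) ^ H.length)]
    refine mul_le_mul_of_nonneg_left ?_ (by positivity)
    refine (add_le_add h3 (mul_le_mul h1 (add_le_add h2 le_rfl)
      (add_nonneg (norm1_nonneg _) zero_le_one) hη0)).trans ?_
    have h6 : η * ((c : ℝ) * 1 + 1) ≤ η * (2 * S) := by gcongr; linarith
    have h7 : η * (2 * S) ≤ (2 * S) * (η * (norm1 x' + 1)) := by
      nlinarith [mul_nonneg (mul_nonneg hη0 hx') hS0]
    have h8 : 0 ≤ η * (norm1 x' + 1) := by positivity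
    have h9 : S * (η * (norm1 x' + 1)) ≤ S ^ 2 * (η * (norm1 x' + 1)) := by
      gcongr
      nlinarith
    nlinarith [mul_nonneg (sq_nonneg S) hx]

lemma continuous_network : ∀ (a : ℕ) (H : List ℕ) (b : ℕ),
    Continuous fun p : Params a H b × (Fin a → ℝ) => network a H b p.1 p.2
  | a, [], b => by
    unfold network
    fun_prop
  | a, c :: H, b => by
    have ht : Continuous Real.tanh := lipschitzWith_tanh.continuous
    have hf : Continuous fun p : Params a (c :: H) b × (Fin a → ℝ) =>
        ((fun q => p.1 (Sum.inr q) : Params c H b), (fun j => Real.tanh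
        (∑ k, p.1 (Sum.inl (Sum.inl (j, k))) * p.2 k + p.1 (Sum.inl (Sum.inr j))) : Fin c → ℝ)) := by
      refine Continuous.prodMk ?_ ?_
      · exact continuous_pi fun q => (continuous_apply _).comp continuous_fst
      · refine continuous_pi fun j => ht.comp ?_
        fun_prop
    exact (continuous_network c H b).comp hf

/-! ### Parameter counts and consequences of the size bound -/

lemma card_paramIdx_le {S : ℝ} : ∀ (a : ℕ) (H : List ℕ) (b : ℕ) (_ : SizesLe a H b S),
    (Fintype.card (ParamIdx a H b) : ℝ) ≤ (depth H : ℝ) * (S ^ 2 + S)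
  | a, [], b, hs => by
    have : Fintype.card (ParamIdx a [] b) = b * a + b := by
      change Fintype.card ((Fin b × Fin a) ⊕ Fin b) = _
      simp
    rw [this]
    have h1 := hs.1
    have h2 := hs.2.1
    have h3 : (0 : ℝ) ≤ a := a.cast_nonneg
    have h4 : (0 : ℝ) ≤ b := b.cast_nonneg
    simp only [depth, List.length_nil]
    push_cast
    nlinarith
  | a, c :: H, b, hs => by
    have : Fintype.card (ParamIdx a (c :: H) b) = (c * a + c) + Fintype.card (ParamIdx c H b) := by
      change Fintype.card (((Fin c × Fin a) ⊕ Fin c) ⊕ ParamIdx c H b) = _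
      simp
    rw [this]
    have ih := card_paramIdx_le c H b hs.tail
    have h1 := hs.1
    have h2 := hs.tail.1
    have h3 : (0 : ℝ) ≤ a := a.cast_nonneg
    have h4 : (0 : ℝ) ≤ c := c.cast_nonneg
    simp only [depth, List.length_cons] at ih ⊢
    push_cast at ih ⊢
    nlinarith

lemma le_foldr_max {l : List ℕ} {c : ℕ} (h : c ∈ l) : c ≤ l.foldr max 0 := by
  induction l with
  | nil => simp at h
  | cons x l ih =>
    rcases List.mem_cons.1 h with rfl | h
    · exact le_max_left _ _
    · exact (ih h).trans (le_max_right _ _)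

lemma sizesLe_of_netSize_le {d : ℕ} {H : List ℕ} {R S : ℝ} (h : netSize d H R ≤ S) :
    R ≤ S ∧ (depth H : ℝ) ≤ S ∧ 1 ≤ S ∧ SizesLe d H 1 S ∧ SizesLe d H d S := by
  have hR : R ≤ S := (le_max_left _ _).trans h
  have hD : (depth H : ℝ) ≤ S := (le_max_left _ _).trans ((le_max_right _ _).trans h)
  have hW : (width d H 1 : ℝ) ≤ S := (le_max_right _ _).trans ((le_max_right _ _).trans h)
  have hc : ∀ c ∈ d :: (H ++ [1]), (c : ℝ) ≤ S := fun c hc =>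
    (Nat.cast_le.2 (le_foldr_max hc)).trans hW
  -- The output width 1 forces S ≥ 1. The output width d of the second network is already counted as
  -- the input width of the first.
  have h1 : (1 : ℝ) ≤ S := by simpa using hc 1 (by simp)
  have hd : (d : ℝ) ≤ S := hc d (by simp)
  have hH : ∀ c ∈ H, (c : ℝ) ≤ S := fun c h => hc c (by simp [h])
  exact ⟨hR, hD, h1, ⟨hd, by simpa using h1, hH⟩, ⟨hd, hd, hH⟩⟩

/-! ### Finite nets of balls in the sup norm -/

/-- A grid of mesh r, clipped to [-R, R]: the centres must obey the parameter bound too, since the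
Lipschitz estimate for the squared residual uses the growth bound at both parameters. -/
lemma exists_net_Icc {R r : ℝ} (hR : 0 ≤ R) (hr : 0 < r) :
    ∃ N : Finset ℝ, (∀ c ∈ N, |c| ≤ R) ∧ (∀ x, |x| ≤ R → ∃ c ∈ N, |x - c| ≤ r) ∧
      (N.card : ℝ) ≤ 2 * R / r + 3 := by
  set L : ℤ := ⌈R / r⌉ with hL
  have hL0 : 0 ≤ L := Int.ceil_nonneg (by positivity)
  refine ⟨(Finset.Icc (-L) L).image fun k : ℤ => max (-R) (min R (r * k)), ?_, ?_, ?_⟩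
  · intro c hc
    obtain ⟨k, -, rfl⟩ := Finset.mem_image.1 hc
    exact abs_le.2 ⟨le_max_left _ _, max_le (by linarith) (min_le_left _ _)⟩
  · intro x hx
    obtain ⟨hx1, hx2⟩ := abs_le.1 hx
    -- The grid point just below x is at most R, so only the clipping at -R can act, and it moves
    -- the point towards x.
    refine ⟨_, Finset.mem_image_of_mem _ (a := ⌊x / r⌋) (Finset.mem_Icc.2 ⟨?_, ?_⟩), ?_⟩
    · rw [hL, ← Int.floor_neg]
      refine Int.floor_le_floor ?_
      rw [← neg_div]
      gcongr
    · exact (Int.floor_le_floor (by gcongr)).trans (Int.floor_le_ceil _)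
    · have h1 : r * (⌊x / r⌋ : ℝ) ≤ x := by
        have := Int.floor_le (x / r)
        rw [le_div_iff₀ hr] at this
        linarith
      have h2 : x ≤ r * (⌊x / r⌋ : ℝ) + r := by
        have := (Int.lt_floor_add_one (x / r)).le
        rw [div_le_iff₀ hr] at this
        linarith
      rw [min_eq_right (h1.trans hx2)]
      rcases max_cases (-R) (r * (⌊x / r⌋ : ℝ)) with h | h <;> rw [h.1, abs_le] <;>
        constructor <;> linarith
  · refine (Nat.cast_le.2 Finset.card_image_le).trans ?_
    rw [Int.card_Icc]
    have h3 : (((L + 1 - -L).toNat : ℕ) : ℝ) = 2 * L + 1 := by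
      have : (((L + 1 - -L).toNat : ℕ) : ℤ) = 2 * L + 1 := by omega
      exact_mod_cast this
    have h4 : (L : ℝ) < R / r + 1 := Int.ceil_lt_add_one _
    rw [h3, mul_div_assoc]
    linarith

lemma exists_net_pi {ι : Type*} [Fintype ι] {R r : ℝ} (hR : 0 ≤ R) (hr : 0 < r) :
    ∃ N : Finset (ι → ℝ), (∀ c ∈ N, ‖c‖ ≤ R) ∧ (∀ x : ι → ℝ, ‖x‖ ≤ R → ∃ c ∈ N, ‖x - c‖ ≤ r) ∧
      (N.card : ℝ) ≤ (2 * R / r + 3) ^ Fintype.card ι := by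
  classical
  obtain ⟨N, h1, h2, h3⟩ := exists_net_Icc hR hr
  refine ⟨Fintype.piFinset fun _ => N, ?_, ?_, ?_⟩
  · intro c hc
    rw [Fintype.mem_piFinset] at hc
    exact (pi_norm_le_iff_of_nonneg hR).2 fun i => h1 _ (hc i)
  · intro x hx
    choose c hc hxc using fun i => h2 (x i) ((norm_le_pi_norm x i).trans hx)
    exact ⟨c, Fintype.mem_piFinset.2 hc, (pi_norm_le_iff_of_nonneg hr.le).2 hxc⟩
  · rw [Fintype.card_piFinset]
    simp only [Finset.prod_const, Finset.card_univ, Nat.cast_pow]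
    gcongr

lemma exists_net_prod {ι κ : Type*} [Fintype ι] [Fintype κ] {R r : ℝ} (hR : 0 ≤ R) (hr : 0 < r) :
    ∃ N : Finset ((ι → ℝ) × (κ → ℝ)), (∀ c ∈ N, ‖c‖ ≤ R) ∧
      (∀ x : (ι → ℝ) × (κ → ℝ), ‖x‖ ≤ R → ∃ c ∈ N, ‖x - c‖ ≤ r) ∧
      (N.card : ℝ) ≤ (2 * R / r + 3) ^ (Fintype.card ι + Fintype.card κ) := by
  classical
  obtain ⟨N, h1, h2, h3⟩ := exists_net_pi (ι := ι) hR hr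
  obtain ⟨N', h1', h2', h3'⟩ := exists_net_pi (ι := κ) hR hr
  refine ⟨N ×ˢ N', ?_, ?_, ?_⟩
  · rintro ⟨c, c'⟩ hc
    rw [Finset.mem_product] at hc
    exact max_le (h1 _ hc.1) (h1' _ hc.2)
  · rintro ⟨x, x'⟩ hx
    obtain ⟨c, hc, hxc⟩ := h2 x ((le_max_left _ _).trans hx)
    obtain ⟨c', hc', hxc'⟩ := h2' x' ((le_max_right _ _).trans hx)
    exact ⟨(c, c'), Finset.mem_product.2 ⟨hc, hc'⟩, max_le hxc hxc'⟩
  · rw [Finset.card_product, pow_add, Nat.cast_mul]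
    gcongr

/-! ### Expected excess risk of empirical risk minimizers -/

section Concentration

variable {Ω 𝓧 : Type*} [MeasurableSpace Ω] [MeasurableSpace 𝓧] {μ : Measure Ω}
  [IsProbabilityMeasure μ] {ν : Measure 𝓧}

/-- Exponential moments of the deviation of an empirical mean of a bounded function. -/
lemma integrable_exp_and_integral_exp_deviation_le {m : ℕ} (hm : 0 < m) {w : Fin m → Ω → 𝓧}
    (hw : ∀ j, Measurable (w j)) (hlaw : ∀ j, μ.map (w j) = ν) (hind : iIndepFun w μ)
    {F : 𝓧 → ℝ} (hF : Measurable F) {K : ℝ} (hK : ∀ x, F x ∈ Set.Icc 0 K) (lam : ℝ) :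
    Integrable (fun ω => Real.exp (lam * (∫ x, F x ∂ν - (1 / (m : ℝ)) * ∑ j, F (w j ω)))) μ ∧
      ∫ ω, Real.exp (lam * (∫ x, F x ∂ν - (1 / (m : ℝ)) * ∑ j, F (w j ω))) ∂μ
        ≤ Real.exp (lam ^ 2 * K ^ 2 / (8 * m)) := by
  have hm' : (m : ℝ) ≠ 0 := by positivity
  have hE : ∀ j, ∫ ω, F (w j ω) ∂μ = ∫ x, F x ∂ν := fun j => by
    rw [← hlaw j, integral_map (hw j).aemeasurable hF.aestronglyMeasurable]
  -- Hoeffding's lemma: values in [0, K] give the variance proxy K²/4. The centred sum has proxy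
  -- mK²/4, and evaluating its moment generating function at -λ/m produces λ²K²/(8m).
  have h1 : ∀ j ∈ Finset.univ, HasSubgaussianMGF (fun ω => F (w j ω) - ∫ x, F x ∂ν)
      ((‖K - 0‖₊ / 2) ^ 2) μ := fun j _ => by
    have := hasSubgaussianMGF_of_mem_Icc (X := fun ω => F (w j ω)) (μ := μ)
      (hF.comp (hw j)).aemeasurable (ae_of_all _ fun ω => hK (w j ω))
    rwa [hE] at this
  have h2 := HasSubgaussianMGF.sum_of_iIndepFun
    (hind.comp (fun _ x => F x - ∫ x, F x ∂ν) fun _ => hF.sub_const _) h1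
  have e : ∀ ω, lam * (∫ x, F x ∂ν - (1 / (m : ℝ)) * ∑ j, F (w j ω))
      = (-lam / m) * ∑ j, (F (w j ω) - ∫ x, F x ∂ν) := fun ω => by
    rw [Finset.sum_sub_distrib]
    simp only [Finset.sum_const, Finset.card_univ, Fintype.card_fin, nsmul_eq_mul]
    field_simp
    ring
  simp_rw [e]
  refine ⟨h2.integrable_exp_mul _, (h2.mgf_le (-lam / m)).trans (le_of_eq ?_)⟩
  congr 1
  simp only [Finset.sum_const, Finset.card_univ, Fintype.card_fin, nsmul_eq_mul, sub_zero]
  push_cast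
  rw [div_pow, Real.norm_eq_abs, sq_abs]
  field_simp
  ring

/-- Truncation acts only where x > K, and there x ≤ x²/K. Thus a second moment controls the
truncation error. -/
lemma sub_min_le_sq_div {x K : ℝ} (hK : 0 < K) : x - min x K ≤ x ^ 2 / K := by
  rw [le_div_iff₀ hK]
  rcases min_cases x K with h | h <;> rw [h.1] <;> nlinarith [sq_nonneg (x - K)]

/-- The tangent line of the logarithm at A, evaluated at exp x. It replaces Jensen's inequality in
the bound for the expected maximum over the net. -/
lemma le_log_add_exp_div_sub_one {x A : ℝ} (hA : 0 < A) :
    x ≤ Real.log A + Real.exp x / A - 1 := by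
  have h := Real.log_le_sub_one_of_pos (x := Real.exp x / A) (by positivity)
  rw [Real.log_div (Real.exp_pos _).ne' hA.ne', Real.log_exp] at h
  linarith

variable {Θ : Type*}

/-- A one-sided chain suffices: the risk at the minimizer is compared with the truncated risk, then
with that of a net point, then with its empirical mean. Truncation decreases the integrand, so the
empirical side returns to the original loss at no cost. Minimality passes to θ₀, which is fixed, so
its empirical risk has expectation equal to its risk. The error ℓ is paid twice, once under ν and
once under the empirical measure. -/
theorem integral_risk_minimizer_le [IsProbabilityMeasure ν] {m : ℕ} (hm : 0 < m) {w : Fin m → Ω → 𝓧}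
    (hw : ∀ j, Measurable (w j)) (hlaw : ∀ j, μ.map (w j) = ν) (hind : iIndepFun w μ)
    {g : Θ → 𝓧 → ℝ} (hg0 : ∀ θ x, 0 ≤ g θ x) (hg : ∀ θ, Measurable (g θ))
    {S : Set Θ} {env : 𝓧 → ℝ} (henv : ∀ θ ∈ S, ∀ x, g θ x ≤ env x)
    (henv1 : Integrable env ν) (henv2 : Integrable (fun x => env x ^ 2) ν)
    {ℓ : 𝓧 → ℝ} (hℓ : Integrable ℓ ν) {N : Finset Θ} {r : ℝ}
    (hnet : ∀ θ ∈ S, ∃ c ∈ N, ∀ x, |g θ x - g c x| ≤ r * ℓ x)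
    {K lam : ℝ} (hK : 0 < K) (hlam : 0 < lam) {θ₀ : Θ} (hθ₀ : θ₀ ∈ S) {θm : Ω → Θ}
    (hθm : ∀ ω, θm ω ∈ S) (hmin : ∀ ω, (1 / (m : ℝ)) * ∑ j, g (θm ω) (w j ω)
      ≤ (1 / (m : ℝ)) * ∑ j, g θ₀ (w j ω))
    (hint : Integrable (fun ω => ∫ x, g (θm ω) x ∂ν) μ) :
    ∫ ω, ∫ x, g (θm ω) x ∂ν ∂μ ≤ ∫ x, g θ₀ x ∂ν + (∫ x, env x ^ 2 ∂ν) / K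
      + 2 * r * ∫ x, ℓ x ∂ν + (Real.log N.card / lam + lam * K ^ 2 / (8 * m)) := by
  have hm' : (0 : ℝ) < m := by positivity
  set F : Θ → 𝓧 → ℝ := fun θ x => min (g θ x) K with hFdef
  have hFm : ∀ θ, Measurable (F θ) := fun θ => (hg θ).min measurable_const
  have hFmem : ∀ θ x, F θ x ∈ Set.Icc 0 K := fun θ x =>
    ⟨le_min (hg0 _ _) hK.le, min_le_right _ _⟩
  have hFint : ∀ θ, Integrable (F θ) ν := fun θ =>
    Integrable.of_mem_Icc 0 K (hFm θ).aemeasurable (ae_of_all _ (hFmem θ))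
  have hgint : ∀ θ ∈ S, Integrable (g θ) ν := fun θ hθ =>
    henv1.mono' (hg θ).aestronglyMeasurable (ae_of_all _ fun x => by
      rw [Real.norm_of_nonneg (hg0 _ _)]; exact henv θ hθ x)
  -- Truncation is 1-Lipschitz, so the net estimate survives it.
  have hFlip : ∀ θ c x, |g θ x - g c x| ≤ r * ℓ x → |F θ x - F c x| ≤ r * ℓ x := fun θ c x h =>
    (abs_min_sub_min_le_max _ _ _ _).trans (by simpa using h)
  -- expectations of functions of one sample point
  have hE : ∀ (φ : 𝓧 → ℝ), Integrable φ ν → Integrable (fun ω => (1 / (m : ℝ)) * ∑ j, φ (w j ω)) μ ∧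
      ∫ ω, (1 / (m : ℝ)) * ∑ j, φ (w j ω) ∂μ = ∫ x, φ x ∂ν := by
    intro φ hφ
    have h1 : ∀ j, Integrable (fun ω => φ (w j ω)) μ := fun j => by
      have := hφ
      rw [← hlaw j] at this
      exact this.comp_measurable (hw j)
    have h2 : ∀ j, ∫ ω, φ (w j ω) ∂μ = ∫ x, φ x ∂ν := fun j => by
      have := hφ.aestronglyMeasurable
      rw [← hlaw j] at this
      rw [← integral_map (hw j).aemeasurable this, hlaw j]
    refine ⟨(integrable_finsetSum _ fun j _ => h1 j).const_mul _, ?_⟩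
    rw [integral_const_mul, integral_finsetSum _ fun j _ => h1 j]
    simp only [h2, Finset.sum_const, Finset.card_univ, Fintype.card_fin, nsmul_eq_mul]
    field_simp
  set Y : Θ → Ω → ℝ := fun c ω => ∫ x, F c x ∂ν - (1 / (m : ℝ)) * ∑ j, F c (w j ω) with hY
  have hexp := fun c => integrable_exp_and_integral_exp_deviation_le hm hw hlaw hind (hFm c)
    (hFmem c) lam
  obtain ⟨c₀, hc₀, -⟩ := hnet θ₀ hθ₀
  have hcard : (0 : ℝ) < N.card := by
    have := Finset.card_pos.2 ⟨c₀, hc₀⟩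
    positivity
  set A : ℝ := N.card * Real.exp (lam ^ 2 * K ^ 2 / (8 * m)) with hA
  have hA0 : 0 < A := by positivity
  -- An integrable common bound for all the deviations `Y c`, valid also for a net point chosen
  -- depending on ω. With `A` equal to the bound of the expected sum of exponentials, the terms -1
  -- and (sum)/A cancel in expectation up to sign.
  set V : Ω → ℝ := fun ω => lam⁻¹ * (Real.log A - 1 + (∑ c ∈ N, Real.exp (lam * Y c ω)) / A) with hV
  have hYV : ∀ c ∈ N, ∀ ω, Y c ω ≤ V ω := by
    intro c hc ω
    have h1 := le_log_add_exp_div_sub_one (x := lam * Y c ω) hA0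
    have h2 : Real.exp (lam * Y c ω) ≤ ∑ c ∈ N, Real.exp (lam * Y c ω) :=
      Finset.single_le_sum (f := fun c => Real.exp (lam * Y c ω))
        (fun _ _ => (Real.exp_pos _).le) hc
    have h3 : Real.exp (lam * Y c ω) / A ≤ (∑ c ∈ N, Real.exp (lam * Y c ω)) / A := by gcongr
    simp only [hV]
    rw [inv_mul_eq_div, le_div_iff₀ hlam]
    linarith
  have hsumint : Integrable (fun ω => ∑ c ∈ N, Real.exp (lam * Y c ω)) μ :=
    integrable_finsetSum _ fun c _ => (hexp c).1
  have hVint : Integrable V μ :=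
    ((integrable_const _).add (hsumint.div_const _)).const_mul _
  have hVle : ∫ ω, V ω ∂μ ≤ Real.log N.card / lam + lam * K ^ 2 / (8 * m) := by
    have h1 : ∫ ω, ∑ c ∈ N, Real.exp (lam * Y c ω) ∂μ ≤ A := by
      rw [integral_finsetSum _ fun c _ => (hexp c).1]
      refine (Finset.sum_le_sum fun c _ => (hexp c).2).trans ?_
      simp [hA]
    have h2 : ∫ ω, V ω ∂μ = lam⁻¹ * (Real.log A - 1
        + (∫ ω, ∑ c ∈ N, Real.exp (lam * Y c ω) ∂μ) / A) := by
      simp only [hV]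
      rw [integral_const_mul, integral_add (integrable_const _) (hsumint.div_const _),
        integral_div]
      simp
    have h3 : (∫ ω, ∑ c ∈ N, Real.exp (lam * Y c ω) ∂μ) / A ≤ 1 := (div_le_one hA0).2 h1
    have h4 : Real.log A = Real.log N.card + lam ^ 2 * K ^ 2 / (8 * m) := by
      rw [hA, Real.log_mul hcard.ne' (Real.exp_pos _).ne', Real.log_exp]
    rw [h2]
    calc _ ≤ lam⁻¹ * (Real.log N.card + lam ^ 2 * K ^ 2 / (8 * m)) := by
            refine mul_le_mul_of_nonneg_left ?_ (by positivity)
            linarith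
      _ = _ := by field_simp
  have hpoint : ∀ ω, ∫ x, g (θm ω) x ∂ν ≤ (1 / (m : ℝ)) * ∑ j, g θ₀ (w j ω)
      + (∫ x, env x ^ 2 ∂ν) / K + r * ∫ x, ℓ x ∂ν + r * ((1 / (m : ℝ)) * ∑ j, ℓ (w j ω))
      + V ω := by
    intro ω
    obtain ⟨c, hc, hcl⟩ := hnet _ (hθm ω)
    have h1 : ∫ x, g (θm ω) x ∂ν ≤ ∫ x, F (θm ω) x ∂ν + (∫ x, env x ^ 2 ∂ν) / K := by
      rw [← integral_div, ← integral_add (hFint _) (henv2.div_const _)]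
      refine integral_mono (hgint _ (hθm ω)) ((hFint _).add (henv2.div_const _)) fun x => ?_
      have h := sub_min_le_sq_div (x := g (θm ω) x) hK
      have h' : g (θm ω) x ^ 2 / K ≤ env x ^ 2 / K := by
        have := hg0 (θm ω) x
        have := henv _ (hθm ω) x
        gcongr
      simp only [hFdef]
      linarith
    have h2 : ∫ x, F (θm ω) x ∂ν ≤ ∫ x, F c x ∂ν + r * ∫ x, ℓ x ∂ν := by
      rw [← integral_const_mul, ← integral_add (hFint _) (hℓ.const_mul _)]
      refine integral_mono (hFint _) ((hFint _).add (hℓ.const_mul _)) fun x => ?_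
      have := (abs_le.1 (hFlip _ _ x (hcl x))).2
      simp only
      linarith
    have h3 : (1 / (m : ℝ)) * ∑ j, F c (w j ω)
        ≤ (1 / (m : ℝ)) * ∑ j, g (θm ω) (w j ω) + r * ((1 / (m : ℝ)) * ∑ j, ℓ (w j ω)) := by
      rw [← mul_assoc, mul_comm r, mul_assoc, ← mul_add, Finset.mul_sum _ _ r,
        ← Finset.sum_add_distrib]
      refine mul_le_mul_of_nonneg_left (Finset.sum_le_sum fun j _ => ?_) (by positivity)
      have := (abs_le.1 (hFlip _ _ _ (hcl (w j ω)))).1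
      have : F (θm ω) (w j ω) ≤ g (θm ω) (w j ω) := min_le_left _ _
      linarith
    have h4 : ∫ x, F c x ∂ν - (1 / (m : ℝ)) * ∑ j, F c (w j ω) ≤ V ω := hYV c hc ω
    linarith [hmin ω]
  have hI1 := hE _ (hgint θ₀ hθ₀)
  have hI2 := hE _ hℓ
  have hB1 : Integrable (fun ω => (1 / (m : ℝ)) * ∑ j, g θ₀ (w j ω)
      + (∫ x, env x ^ 2 ∂ν) / K) μ := hI1.1.add (integrable_const _)
  have hB2 : Integrable (fun ω => (1 / (m : ℝ)) * ∑ j, g θ₀ (w j ω)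
      + (∫ x, env x ^ 2 ∂ν) / K + r * ∫ x, ℓ x ∂ν) μ := hB1.add (integrable_const _)
  have hB3 : Integrable (fun ω => (1 / (m : ℝ)) * ∑ j, g θ₀ (w j ω)
      + (∫ x, env x ^ 2 ∂ν) / K + r * ∫ x, ℓ x ∂ν + r * ((1 / (m : ℝ)) * ∑ j, ℓ (w j ω))) μ :=
    hB2.add (hI2.1.const_mul _)
  refine (integral_mono hint (hB3.add hVint) hpoint).trans ?_
  simp only [Pi.add_apply]
  rw [integral_add hB3 hVint, integral_add hB2 (hI2.1.const_mul _),
    integral_add hB1 (integrable_const _), integral_add hI1.1 (integrable_const _), hI1.2,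
    integral_const_mul r (fun ω => (1 / (m : ℝ)) * ∑ j, ℓ (w j ω)), hI2.2]
  simp only [integral_const, probReal_univ, smul_eq_mul, one_mul]
  linarith

end Concentration

/-! ### The forward process: measurability, growth, moments, independence -/

instance instIsProbabilityMeasureSampleLaw (d : ℕ) : IsProbabilityMeasure (sampleLaw d) := by
  unfold sampleLaw
  infer_instance

lemma TimeGrid.time_nonneg {T : ℝ} (G : TimeGrid T) (i : Fin G.N) : 0 ≤ G.time i := by
  rw [← G.t_zero]
  exact G.strictMono.monotone (Fin.zero_le _)

lemma TimeGrid.time_le {T : ℝ} (G : TimeGrid T) (i : Fin G.N) : G.time i ≤ T :=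
  (G.strictMono.monotone (Fin.le_last _)).trans_eq G.t_last

lemma TimeGrid.step_pos {T : ℝ} (G : TimeGrid T) (i : Fin G.N) : 0 < G.step i :=
  sub_pos.2 (G.strictMono i.castSucc_lt_succ)

lemma TimeGrid.step_le {T : ℝ} (G : TimeGrid T) (i : Fin G.N) : G.step i ≤ T := by
  have h1 : G.t i.succ ≤ T := (G.strictMono.monotone (Fin.le_last _)).trans_eq G.t_last
  have h2 := G.time_nonneg i
  unfold TimeGrid.time at h2
  unfold TimeGrid.step
  linarith

lemma measurable_initial (P : ModelParams) {d : ℕ} (k : Fin d) :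
    Measurable fun w : Sample d => initial P w k := by
  unfold initial
  have := (monotone_cdf (gaussianReal 0 1)).measurable
  fun_prop

lemma measurable_state (e : EquationType) (P : ModelParams) {d : ℕ} (t : ℝ) :
    Measurable fun w : Sample d => state e P t w := by
  refine measurable_pi_lambda _ fun k => ?_
  have := measurable_initial P k
  cases e <;> simp only [state, brownian] <;> fun_prop

lemma measurable_increment {d : ℕ} (Δ : ℝ) : Measurable fun w : Sample d => increment Δ w := by
  unfold increment
  fun_prop

lemma measurable_nextState (e : EquationType) (P : ModelParams) {d : ℕ} (t Δ : ℝ) :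
    Measurable fun w : Sample d => nextState e P t Δ w := by
  refine measurable_pi_lambda _ fun k => ?_
  have h1 := (measurable_pi_apply k).comp (measurable_state e P (d := d) t)
  have h2 := (measurable_pi_apply k).comp (measurable_increment (d := d) Δ)
  simp only [Function.comp_def] at h1 h2
  cases e <;> simp only [nextState] <;> fun_prop

/-! ### Growth of the forward process, uniformly in time -/

lemma abs_initial_le (P : ModelParams) {d : ℕ} (w : Sample d) (k : Fin d) :
    |initial P w k| ≤ |P.a| + |P.b| := by
  have h0 := cdf_nonneg (gaussianReal 0 1) (w 0 k)
  have h1 := cdf_le_one (gaussianReal 0 1) (w 0 k)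
  have hab := P.a_lt_b
  unfold initial
  set q := cdf (gaussianReal 0 1) (w 0 k)
  have h2 : 0 ≤ (P.b - P.a) * q := mul_nonneg (by linarith) h0
  have h3 : (P.b - P.a) * q ≤ P.b - P.a := mul_le_of_le_one_right (by linarith) h1
  have h4 := abs_nonneg P.a
  have h5 := abs_nonneg P.b
  rw [abs_le]
  constructor
  · linarith [neg_abs_le P.a]
  · linarith [le_abs_self P.b]

/-- A bound for the `k`-th coordinates of the forward process and of the Brownian increments
that is uniform in time. -/
noncomputable def growth (P : ModelParams) {d : ℕ} (w : Sample d) (k : Fin d) : ℝ :=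
  (1 + |P.a| + |P.b|) * Real.exp (2 * ((|P.μ| + P.σ ^ 2) * P.T)
    + √P.T * (|P.σ| + 1) * (|w 1 k| + |w 2 k|))

lemma one_le_growth (P : ModelParams) {d : ℕ} (w : Sample d) (k : Fin d) : 1 ≤ growth P w k := by
  have hT := P.T_pos.le
  have h : 1 ≤ Real.exp (2 * ((|P.μ| + P.σ ^ 2) * P.T)
    + √P.T * (|P.σ| + 1) * (|w 1 k| + |w 2 k|)) := Real.one_le_exp (by positivity)
  unfold growth
  nlinarith [abs_nonneg P.a, abs_nonneg P.b]

/-- With A = |a| + |b| and z ≥ 0, A + z ≤ (1 + A)(1 + z) ≤ (1 + A) exp z. This puts the additive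
heat case under the same exponential bound as the Black–Scholes case. -/
lemma le_growth_of_le {P : ModelParams} {d : ℕ} {w : Sample d} {k : Fin d} {x : ℝ}
    (h : x ≤ (|P.a| + |P.b|) + (2 * ((|P.μ| + P.σ ^ 2) * P.T)
      + √P.T * (|P.σ| + 1) * (|w 1 k| + |w 2 k|))) : x ≤ growth P w k := by
  unfold growth
  set z := 2 * ((|P.μ| + P.σ ^ 2) * P.T) + √P.T * (|P.σ| + 1) * (|w 1 k| + |w 2 k|) with hz
  have hT := P.T_pos.le
  have hz0 : 0 ≤ z := by positivity
  have h1 := Real.add_one_le_exp z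
  nlinarith [abs_nonneg P.a, abs_nonneg P.b]

lemma mul_exp_le_growth {P : ModelParams} {d : ℕ} {w : Sample d} {k : Fin d} {x z : ℝ}
    (hx : |x| ≤ |P.a| + |P.b|) (h : z ≤ 2 * ((|P.μ| + P.σ ^ 2) * P.T)
      + √P.T * (|P.σ| + 1) * (|w 1 k| + |w 2 k|)) : |x * Real.exp z| ≤ growth P w k := by
  rw [abs_mul, Real.abs_exp]
  unfold growth
  gcongr
  linarith

lemma mul_sqrt_mul_le {P : ModelParams} {t : ℝ} (ht : t ≤ P.T) (x : ℝ) :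
    |P.σ * (√t * x)| ≤ √P.T * (|P.σ| + 1) * |x| := by
  rw [abs_mul, abs_mul, abs_of_nonneg (Real.sqrt_nonneg t)]
  have h1 : √t ≤ √P.T := Real.sqrt_le_sqrt ht
  calc |P.σ| * (√t * |x|) ≤ (|P.σ| + 1) * (√P.T * |x|) := by gcongr; linarith
    _ = _ := by ring

lemma drift_mul_le {P : ModelParams} {t : ℝ} (ht0 : 0 ≤ t) (ht : t ≤ P.T) :
    |P.μ * t| ≤ (|P.μ| + P.σ ^ 2) * P.T ∧
      (P.μ - P.σ ^ 2 / 2) * t ≤ (|P.μ| + P.σ ^ 2) * P.T := by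
  constructor
  · rw [abs_mul, abs_of_nonneg ht0]
    gcongr
    nlinarith [sq_nonneg P.σ]
  · have : P.μ - P.σ ^ 2 / 2 ≤ |P.μ| + P.σ ^ 2 := by
      nlinarith [sq_nonneg P.σ, le_abs_self P.μ]
    calc _ ≤ (|P.μ| + P.σ ^ 2) * t := by gcongr
      _ ≤ _ := by gcongr

lemma abs_state_le (e : EquationType) {P : ModelParams} {d : ℕ} {t : ℝ} (ht0 : 0 ≤ t)
    (ht : t ≤ P.T) (w : Sample d) (k : Fin d) : |state e P t w k| ≤ growth P w k := by
  have h1 := abs_initial_le P w k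
  have h2 := mul_sqrt_mul_le ht (w 1 k)
  have h3 := drift_mul_le ht0 ht
  have h4 : 0 ≤ √P.T * (|P.σ| + 1) * |w 2 k| := by positivity
  have h5 : 0 ≤ (|P.μ| + P.σ ^ 2) * P.T := (abs_nonneg _).trans h3.1
  cases e
  · refine le_growth_of_le ?_
    simp only [state, brownian]
    refine (abs_add_three _ _ _).trans ?_
    linarith [h3.1]
  · simp only [state, brownian]
    refine mul_exp_le_growth h1 ?_
    linarith [h3.2, le_abs_self (P.σ * (√t * w 1 k))]

/-- The drift acts over two time spans, each of length at most T, which accounts for the factor 2 in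
`growth`; the two Gaussian blocks enter once each. -/
lemma abs_nextState_le (e : EquationType) {P : ModelParams} {d : ℕ} {t Δ : ℝ} (ht0 : 0 ≤ t)
    (ht : t ≤ P.T) (hΔ0 : 0 ≤ Δ) (hΔ : Δ ≤ P.T) (w : Sample d) (k : Fin d) :
    |nextState e P t Δ w k| ≤ growth P w k := by
  have h1 := abs_initial_le P w k
  have h2 := mul_sqrt_mul_le ht (w 1 k)
  have h3 := drift_mul_le ht0 ht
  have h2' := mul_sqrt_mul_le hΔ (w 2 k)
  have h3' := drift_mul_le hΔ0 hΔ
  cases e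
  · refine le_growth_of_le ?_
    simp only [nextState, increment, state, brownian]
    refine (abs_add_three _ _ _).trans ?_
    have := abs_add_three (initial P w k) (P.μ * t) (P.σ * (√t * w 1 k))
    linarith [h3.1, h3'.1]
  · simp only [nextState, increment, state, brownian]
    rw [mul_assoc, ← Real.exp_add]
    refine mul_exp_le_growth h1 ?_
    linarith [h3.2, le_abs_self (P.σ * (√t * w 1 k)), h3'.2, le_abs_self (P.σ * (√Δ * w 2 k))]

/-- The increment carries no factor σ; the summand 1 next to |σ| in `growth` covers it. -/
lemma abs_increment_le {P : ModelParams} {d : ℕ} {Δ : ℝ} (hΔ : Δ ≤ P.T) (w : Sample d)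
    (k : Fin d) : |increment Δ w k| ≤ growth P w k := by
  refine le_growth_of_le ?_
  have hT := P.T_pos.le
  have h1 : √Δ ≤ √P.T := Real.sqrt_le_sqrt hΔ
  have h2 : √Δ * |w 2 k| ≤ √P.T * |w 2 k| := by gcongr
  have h3 : 0 ≤ √P.T * (|P.σ| + 1) * |w 1 k| := by positivity
  have h4 : 0 ≤ √P.T * |P.σ| * |w 2 k| := by positivity
  have h5 : 0 ≤ (|P.μ| + P.σ ^ 2) * P.T := by positivity
  simp only [increment]
  rw [abs_mul, abs_of_nonneg (Real.sqrt_nonneg _)]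
  linarith [abs_nonneg P.a, abs_nonneg P.b]

/-- A random variable that dominates the `ℓ¹`-norms of the forward process and of the Brownian
increments. -/
noncomputable def dominant (P : ModelParams) {d : ℕ} (w : Sample d) : ℝ := ∑ k, growth P w k

lemma norm1_le_dominant {P : ModelParams} {d : ℕ} {w : Sample d} {x : Fin d → ℝ}
    (h : ∀ k, |x k| ≤ growth P w k) : norm1 x ≤ dominant P w :=
  Finset.sum_le_sum fun k _ => h k

lemma one_le_dominant (P : ModelParams) {d : ℕ} (hd : 1 ≤ d) (w : Sample d) :
    1 ≤ dominant P w :=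
  (one_le_growth P w ⟨0, hd⟩).trans (Finset.single_le_sum
    (fun k _ => zero_le_one.trans (one_le_growth P w k)) (Finset.mem_univ (⟨0, hd⟩ : Fin d)))

lemma measurable_growth (P : ModelParams) {d : ℕ} (k : Fin d) :
    Measurable fun w : Sample d => growth P w k := by
  unfold growth
  fun_prop

lemma measurable_dominant (P : ModelParams) {d : ℕ} :
    Measurable fun w : Sample d => dominant P w :=
  Finset.measurable_sum _ fun k _ => measurable_growth P k

/-! ### Moments of the dominating variable -/

lemma measurePreserving_sample {d : ℕ} (i : Fin 3) (k : Fin d) :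
    MeasurePreserving (fun w : Sample d => w i k) (sampleLaw d) (gaussianReal 0 1) :=
  (measurePreserving_eval (fun _ : Fin d => gaussianReal 0 1) k).comp
    (measurePreserving_eval (fun _ : Fin 3 => Measure.pi fun _ : Fin d => gaussianReal 0 1) i)

lemma integrable_exp_mul_abs_gaussianReal (c : ℝ) :
    Integrable (fun x => Real.exp (c * |x|)) (gaussianReal 0 1) := by
  refine ((integrable_exp_mul_gaussianReal c).add (integrable_exp_mul_gaussianReal (-c))).mono'
    (by fun_prop) (ae_of_all _ fun x => ?_)
  rw [Real.norm_of_nonneg (Real.exp_pos _).le, Pi.add_apply]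
  rcases abs_cases x with h | h <;> rw [h.1]
  · exact le_add_of_nonneg_right (Real.exp_pos _).le
  · rw [mul_neg, ← neg_mul]
    exact le_add_of_nonneg_left (Real.exp_pos _).le

/-- The power mean inequality gives (∑ growth)⁸ ≤ d⁷ ∑ growth⁸, and each summand has the same finite
expectation bound, free of d. The eighth power is the square of the envelope ρ⁴ of the squared
residual. -/
lemma exists_dominant_moment_bound (P : ModelParams) : ∃ C : ℝ, 1 ≤ C ∧ ∀ d : ℕ, 1 ≤ d →
    Integrable (fun w : Sample d => dominant P w ^ 8) (sampleLaw d) ∧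
    ∫ w : Sample d, dominant P w ^ 8 ∂(sampleLaw d) ≤ C * (d : ℝ) ^ 8 := by
  set s := √P.T * (|P.σ| + 1) with hs
  set A := (1 + |P.a| + |P.b|) * Real.exp (2 * ((|P.μ| + P.σ ^ 2) * P.T)) with hA
  have hA0 : 0 ≤ A := by positivity
  set E := ∫ x, Real.exp (16 * s * |x|) ∂(gaussianReal 0 1) with hE
  have hexp : ∀ (d : ℕ) (i : Fin 3) (k : Fin d),
      Integrable (fun w : Sample d => Real.exp (16 * s * |w i k|)) (sampleLaw d) ∧
      ∫ w : Sample d, Real.exp (16 * s * |w i k|) ∂(sampleLaw d) = E := by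
    intro d i k
    have hp := measurePreserving_sample i k
    have hi := integrable_exp_mul_abs_gaussianReal (16 * s)
    refine ⟨hp.integrable_comp_of_integrable hi, ?_⟩
    rw [hE, ← hp.map_eq, integral_map hp.measurable.aemeasurable (by fun_prop)]
  have hE0 : 0 ≤ E := integral_nonneg fun x => (Real.exp_pos _).le
  refine ⟨1 + A ^ 8 * (E + E), le_add_of_nonneg_right (by positivity), fun d hd => ?_⟩
  have hd0 : (0 : ℝ) < d := by exact_mod_cast hd
  set b : Sample d → ℝ := fun w => ∑ k, A ^ 8 *
    (Real.exp (16 * s * |w 1 k|) + Real.exp (16 * s * |w 2 k|)) with hb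
  have hbint : Integrable b (sampleLaw d) := integrable_finsetSum _ fun k _ =>
    ((hexp d 1 k).1.add (hexp d 2 k).1).const_mul _
  have hbE : ∫ w, b w ∂(sampleLaw d) = d * (A ^ 8 * (E + E)) := by
    have hki : ∀ k : Fin d, Integrable (fun w : Sample d => A ^ 8 *
        (Real.exp (16 * s * |w 1 k|) + Real.exp (16 * s * |w 2 k|))) (sampleLaw d) := fun k =>
      ((hexp d 1 k).1.add (hexp d 2 k).1).const_mul _
    simp only [hb]
    rw [integral_finsetSum _ fun k _ => hki k]
    have : ∀ k : Fin d, ∫ w : Sample d, A ^ 8 *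
        (Real.exp (16 * s * |w 1 k|) + Real.exp (16 * s * |w 2 k|)) ∂(sampleLaw d)
        = A ^ 8 * (E + E) := fun k => by
      rw [integral_const_mul, integral_add (hexp d 1 k).1 (hexp d 2 k).1, (hexp d 1 k).2,
        (hexp d 2 k).2]
    simp [this]
  have hle : ∀ w : Sample d, dominant P w ^ 8 ≤ (d : ℝ) ^ 7 * b w := by
    intro w
    have h1 := pow_sum_div_card_le_sum_pow (s := Finset.univ) (f := fun k => growth P w k)
      (fun k _ => zero_le_one.trans (one_le_growth P w k)) 7
    rw [Finset.card_univ, Fintype.card_fin, div_le_iff₀ (by positivity)] at h1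
    refine h1.trans ?_
    rw [mul_comm]
    refine mul_le_mul_of_nonneg_left (Finset.sum_le_sum fun k _ => ?_) (by positivity)
    have h2 : growth P w k = A * (Real.exp (s * |w 1 k|) * Real.exp (s * |w 2 k|)) := by
      rw [growth, hA, ← Real.exp_add, mul_assoc (1 + |P.a| + |P.b|), ← Real.exp_add]
      congr 2
      ring
    -- The exponent 16 = 2 · 8 comes from bounding the product of the two Gaussian factors by the
    -- sum of their squares, so independence of the blocks is not needed here.
    have h3 : ∀ x, Real.exp (16 * s * x) = (Real.exp (s * x) ^ 8) ^ 2 := fun x => by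
      rw [← pow_mul, ← Real.exp_nat_mul]
      congr 1
      push_cast
      ring
    rw [h2, mul_pow, h3, h3]
    refine mul_le_mul_of_nonneg_left ?_ (by positivity)
    rw [mul_pow]
    have h4 : 0 ≤ Real.exp (s * |w 1 k|) ^ 8 * Real.exp (s * |w 2 k|) ^ 8 := by positivity
    have h5 := two_mul_le_add_sq (Real.exp (s * |w 1 k|) ^ 8) (Real.exp (s * |w 2 k|) ^ 8)
    have h6 : 7 + 1 = 8 := rfl
    rw [h6]
    linarith
  have hint : Integrable (fun w : Sample d => dominant P w ^ 8) (sampleLaw d) := by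
    refine (hbint.const_mul ((d : ℝ) ^ 7)).mono' ((measurable_dominant P).pow_const 8).aestronglyMeasurable
      (ae_of_all _ fun w => ?_)
    rw [Real.norm_of_nonneg (pow_nonneg (zero_le_one.trans (one_le_dominant P hd w)) 8)]
    exact hle w
  refine ⟨hint, (integral_mono hint (hbint.const_mul _) hle).trans ?_⟩
  rw [integral_const_mul, hbE]
  have : 0 ≤ (d : ℝ) ^ 8 := by positivity
  linarith [show (d : ℝ) ^ 7 * (d * (A ^ 8 * (E + E))) = (A ^ 8 * (E + E)) * d ^ 8 by ring]

lemma integrable_dominant_pow (P : ModelParams) {d : ℕ} (hd : 1 ≤ d) {n : ℕ} (hn : n ≤ 8) :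
    Integrable (fun w : Sample d => dominant P w ^ n) (sampleLaw d) := by
  obtain ⟨C, -, h⟩ := exists_dominant_moment_bound P
  refine (h d hd).1.mono' ((measurable_dominant P).pow_const n).aestronglyMeasurable
    (ae_of_all _ fun w => ?_)
  have := one_le_dominant P hd w
  rw [Real.norm_of_nonneg (by positivity)]
  exact pow_le_pow_right₀ this hn

lemma norm2_nonneg {d : ℕ} (x : Fin d → ℝ) : 0 ≤ norm2 x := Real.sqrt_nonneg _

lemma norm2_sq {d : ℕ} (x : Fin d → ℝ) : norm2 x ^ 2 = ∑ k, x k ^ 2 :=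
  Real.sq_sqrt (Finset.sum_nonneg fun _ _ => sq_nonneg _)

lemma norm2_le_norm1 {d : ℕ} (x : Fin d → ℝ) : norm2 x ≤ norm1 x := by
  refine Real.sqrt_le_iff.2 ⟨norm1_nonneg x, ?_⟩
  simp_rw [← sq_abs (x _)]
  exact Finset.sum_sq_le_sq_sum_of_nonneg fun _ _ => abs_nonneg _

lemma sq_dot_le {d : ℕ} (x y : Fin d → ℝ) : (∑ k, x k * y k) ^ 2 ≤ norm2 x ^ 2 * norm2 y ^ 2 := by
  rw [norm2_sq, norm2_sq]
  exact Finset.sum_mul_sq_le_sq_mul_sq _ _ _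

lemma continuous_norm2 {d : ℕ} : Continuous (norm2 : (Fin d → ℝ) → ℝ) := by
  unfold norm2
  fun_prop

/-! ### Brownian increments: second moment and independence -/

lemma integral_norm2_increment_sq {d : ℕ} {Δ : ℝ} (hΔ : 0 ≤ Δ) :
    Integrable (fun w : Sample d => norm2 (increment Δ w) ^ 2) (sampleLaw d) ∧
      ∫ w : Sample d, norm2 (increment Δ w) ^ 2 ∂(sampleLaw d) = d * Δ := by
  have h2 : MemLp id 2 (gaussianReal 0 1) := memLp_id_gaussianReal 2
  have hg : ∫ x, x ^ 2 ∂(gaussianReal 0 1) = 1 := by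
    have h := variance_of_integral_eq_zero (X := id) (μ := gaussianReal 0 1) aemeasurable_id
      (by simp)
    rw [variance_id_gaussianReal] at h
    simpa using h.symm
  have hk : ∀ k : Fin d, Integrable (fun w : Sample d => (w 2 k) ^ 2) (sampleLaw d) ∧
      ∫ w : Sample d, (w 2 k) ^ 2 ∂(sampleLaw d) = 1 := fun k => by
    have hp := measurePreserving_sample (d := d) 2 k
    refine ⟨hp.integrable_comp_of_integrable (g := fun x => x ^ 2) h2.integrable_sq, ?_⟩
    rw [← hg, ← hp.map_eq, integral_map hp.measurable.aemeasurable (by fun_prop)]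
  have e : ∀ w : Sample d, norm2 (increment Δ w) ^ 2 = ∑ k, Δ * (w 2 k) ^ 2 := fun w => by
    rw [norm2_sq]
    simp only [increment, mul_pow, Real.sq_sqrt hΔ]
  simp_rw [e]
  refine ⟨integrable_finsetSum _ fun k _ => (hk k).1.const_mul _, ?_⟩
  rw [integral_finsetSum _ fun k _ => (hk k).1.const_mul _]
  simp [integral_const_mul, (hk _).2]

lemma indepFun_state_increment (e : EquationType) (P : ModelParams) {d : ℕ} (t Δ : ℝ) :
    IndepFun (fun w : Sample d => state e P t w) (fun w => increment Δ w) (sampleLaw d) := by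
  have h : iIndepFun (fun (i : Fin 3) (w : Sample d) => w i) (sampleLaw d) :=
    iIndepFun_pi (X := fun (_ : Fin 3) (x : Fin d → ℝ) => x) fun _ => aemeasurable_id
  have h' := h.indepFun_prodMk (fun i => measurable_pi_apply i) 0 1 2 (by decide) (by decide)
  have hm : Measurable fun p : (Fin d → ℝ) × (Fin d → ℝ) => (![p.1, p.2, 0] : Sample d) := by
    refine measurable_pi_lambda _ fun i => ?_
    fin_cases i
    · exact measurable_fst
    · exact measurable_snd
    · exact measurable_const
  -- The state reads only the blocks 0 and 1 of the sample; the zero in the third block is a filler.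
  have h1 : (fun w : Sample d => state e P t w)
      = (fun p : (Fin d → ℝ) × (Fin d → ℝ) => state e P t ![p.1, p.2, 0])
        ∘ fun w => (w 0, w 1) := by
    funext w k
    cases e <;> simp [state, initial, brownian]
  have h2 : (fun w : Sample d => increment Δ w) = (fun x : Fin d → ℝ => fun k => √Δ * x k)
      ∘ fun w => w 2 := rfl
  rw [h1, h2]
  exact h'.comp ((measurable_state e P t).comp hm) (by fun_prop)

lemma integral_mul_norm2_increment_sq (e : EquationType) (P : ModelParams) {d : ℕ} (t : ℝ) {Δ : ℝ}
    (hΔ : 0 ≤ Δ) {φ : (Fin d → ℝ) → ℝ} (hφm : Measurable φ)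
    (hφ : Integrable (fun w => φ (state e P t w)) (sampleLaw d)) :
    Integrable (fun w => φ (state e P t w) * norm2 (increment Δ w) ^ 2) (sampleLaw d) ∧
      ∫ w, φ (state e P t w) * norm2 (increment Δ w) ^ 2 ∂(sampleLaw d)
        = (∫ w, φ (state e P t w) ∂(sampleLaw d)) * (d * Δ) := by
  have h := (indepFun_state_increment e P t Δ).comp hφm
    ((continuous_norm2 (d := d)).measurable.pow_const 2)
  obtain ⟨h1, h2⟩ := integral_norm2_increment_sq (d := d) hΔ
  refine ⟨h.integrable_mul hφ h1, ?_⟩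
  rw [← h2]
  exact h.integral_mul_eq_mul_integral hφ.aestronglyMeasurable h1.aestronglyMeasurable

/-! ### The Euclidean norm and the nonlinearity -/

lemma norm2_eq_norm {d : ℕ} (x : Fin d → ℝ) : norm2 x = ‖WithLp.toLp 2 x‖ := by
  simp [EuclideanSpace.norm_eq, norm2]

lemma norm2_add_le {d : ℕ} (x y : Fin d → ℝ) : norm2 (x + y) ≤ norm2 x + norm2 y := by
  simp only [norm2_eq_norm, WithLp.toLp_add]
  exact norm_add_le _ _

lemma norm2_smul {d : ℕ} (s : ℝ) (x : Fin d → ℝ) : norm2 (s • x) = |s| * norm2 x := by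
  simp only [norm2_eq_norm, WithLp.toLp_smul]
  exact norm_smul _ _

lemma norm2_sub_le {d : ℕ} (x y : Fin d → ℝ) : norm2 (x - y) ≤ norm2 x + norm2 y := by
  simp only [norm2_eq_norm, WithLp.toLp_sub]
  exact norm_sub_le _ _

lemma norm2_zero {d : ℕ} : norm2 (0 : Fin d → ℝ) = 0 := by simp [norm2]

namespace PDEData

variable {T : ℝ} {d : ℕ} (D : PDEData T d)

lemma abs_f_sub_le {t : ℝ} (ht : t ∈ Set.Icc 0 T) (x₁ x₂ : Fin d → ℝ) (y₁ y₂ : ℝ)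
    (z₁ z₂ : Fin d → ℝ) : |D.f t x₁ y₁ z₁ - D.f t x₂ y₂ z₂|
      ≤ D.Cf * (norm2 (x₁ - x₂) + |y₁ - y₂| + norm2 (z₁ - z₂)) := by
  simpa using D.f_lip t ht t ht x₁ x₂ y₁ y₂ z₁ z₂

lemma continuous_f {t : ℝ} (ht : t ∈ Set.Icc 0 T) :
    Continuous fun p : (Fin d → ℝ) × ℝ × (Fin d → ℝ) => D.f t p.1 p.2.1 p.2.2 := by
  rw [continuous_iff_continuousAt]
  intro p
  rw [ContinuousAt, tendsto_iff_dist_tendsto_zero]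
  refine squeeze_zero (fun _ => dist_nonneg) (fun q => ?_) (g := fun q =>
    D.Cf * (norm2 (q.1 - p.1) + |q.2.1 - p.2.1| + norm2 (q.2.2 - p.2.2))) ?_
  · exact D.abs_f_sub_le ht _ _ _ _ _ _
  · have h : Continuous fun q : (Fin d → ℝ) × ℝ × (Fin d → ℝ) =>
        D.Cf * (norm2 (q.1 - p.1) + |q.2.1 - p.2.1| + norm2 (q.2.2 - p.2.2)) := by
      have := continuous_norm2 (d := d)
      fun_prop
    simpa [norm2_zero] using h.tendsto p

lemma continuous_g : Continuous D.g := by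
  rw [continuous_iff_continuousAt]
  intro p
  rw [ContinuousAt, tendsto_iff_dist_tendsto_zero]
  refine squeeze_zero (fun _ => dist_nonneg) (fun q => D.g_lip q p) ?_
  have h : Continuous fun q : Fin d → ℝ => D.Cg * norm2 (q - p) := by
    have := continuous_norm2 (d := d)
    fun_prop
  simpa [norm2_zero] using h.tendsto p

/-- The growth of `f`, for a step `Δ` with `C_f Δ < 1`. -/
lemma abs_f_mul_le {t Δ : ℝ} (ht : t ∈ Set.Icc 0 T) (hΔ : 0 ≤ Δ) (hC : D.Cf * Δ < 1)
    (x : Fin d → ℝ) (y : ℝ) (z : Fin d → ℝ) :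
    |D.f t x y z * Δ| ≤ |D.f t 0 0 0| * Δ + norm2 x + D.Cf * Δ * |y| + norm2 z := by
  have h := D.abs_f_sub_le ht x 0 y 0 z 0
  simp only [sub_zero] at h
  have h1 : |D.f t x y z| ≤ |D.f t 0 0 0| + D.Cf * (norm2 x + |y| + norm2 z) := by
    have := abs_sub_abs_le_abs_sub (D.f t x y z) (D.f t 0 0 0)
    linarith
  rw [abs_mul, abs_of_nonneg hΔ]
  calc |D.f t x y z| * Δ ≤ (|D.f t 0 0 0| + D.Cf * (norm2 x + |y| + norm2 z)) * Δ := by gcongr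
    _ = |D.f t 0 0 0| * Δ + D.Cf * Δ * norm2 x + D.Cf * Δ * |y| + D.Cf * Δ * norm2 z := by ring
    _ ≤ |D.f t 0 0 0| * Δ + 1 * norm2 x + D.Cf * Δ * |y| + 1 * norm2 z := by
      have := norm2_nonneg x
      have := norm2_nonneg z
      gcongr
    _ = _ := by ring

/-- The function `u - f(t, ·, u, z) Δ`. -/
def implicitPart (t Δ : ℝ) (u : (Fin d → ℝ) → ℝ) (z : (Fin d → ℝ) → Fin d → ℝ)
    (x : Fin d → ℝ) : ℝ := u x - D.f t x (u x) (z x) * Δ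

lemma measurable_implicitPart {t Δ : ℝ} (ht : t ∈ Set.Icc 0 T) {u : (Fin d → ℝ) → ℝ}
    {z : (Fin d → ℝ) → Fin d → ℝ} (hu : Measurable u) (hz : Measurable z) :
    Measurable (D.implicitPart t Δ u z) :=
  hu.sub (((D.continuous_f ht).measurable.comp
    (measurable_id.prodMk (hu.prodMk hz))).mul_const Δ)

/-- The implicit equation `u - f(t, ·, u, z) Δ = v` has a measurable solution. -/
lemma exists_implicitPart_eq {t Δ : ℝ} (ht : t ∈ Set.Icc 0 T) (hΔ : 0 ≤ Δ) (hC : D.Cf * Δ < 1)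
    {v : (Fin d → ℝ) → ℝ} {z : (Fin d → ℝ) → Fin d → ℝ} (hv : Measurable v) (hz : Measurable z) :
    ∃ u, Measurable u ∧ D.implicitPart t Δ u z = v := by
  set Φ : (Fin d → ℝ) → ℝ → ℝ := fun x y => v x + D.f t x y (z x) * Δ with hΦ
  have hk : 0 ≤ D.Cf * Δ := mul_nonneg D.Cf_pos.le hΔ
  have hcon : ∀ x, ContractingWith ⟨D.Cf * Δ, hk⟩ (Φ x) := fun x => by
    refine ⟨hC, LipschitzWith.of_dist_le_mul fun y y' => ?_⟩
    have h := D.abs_f_sub_le ht x x y y' (z x) (z x)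
    simp only [sub_self, norm2_zero, zero_add, add_zero] at h
    simp only [hΦ, Real.dist_eq, add_sub_add_left_eq_sub, ← sub_mul, abs_mul, abs_of_nonneg hΔ]
    change _ ≤ D.Cf * Δ * |y - y'|
    calc _ ≤ D.Cf * |y - y'| * Δ := by gcongr
      _ = _ := by ring
  -- The pointwise fixed point is measurable in x as the limit of the Picard iterates from 0.
  have hmeas : ∀ n : ℕ, Measurable fun x => (Φ x)^[n] 0 := by
    intro n
    induction n with
    | zero => exact measurable_const
    | succ n ih =>
      simp_rw [Function.iterate_succ_apply']
      exact hv.add (((D.continuous_f ht).measurable.comp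
        (measurable_id.prodMk (ih.prodMk hz))).mul_const Δ)
  refine ⟨fun x => (hcon x).fixedPoint (Φ x), ?_, ?_⟩
  · exact measurable_of_tendsto_metrizable hmeas
      (tendsto_pi_nhds.2 fun x => (hcon x).tendsto_iterate_fixedPoint 0)
  · funext x
    have h : Φ x ((hcon x).fixedPoint (Φ x)) = (hcon x).fixedPoint (Φ x) :=
      (hcon x).fixedPoint_isFixedPt
    simp only [hΦ] at h
    simp only [implicitPart]
    linarith

end PDEData

/-! ### The loss near an optimal pair -/

section L2

variable {α : Type*} [MeasurableSpace α] {ν : Measure α} {A B : α → ℝ}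

lemma integral_sub_mul_sq (hA : MemLp A 2 ν) (hB : MemLp B 2 ν) (s : ℝ) :
    ∫ w, (A w - s * B w) ^ 2 ∂ν
      = ∫ w, A w ^ 2 ∂ν - 2 * s * ∫ w, A w * B w ∂ν + s ^ 2 * ∫ w, B w ^ 2 ∂ν := by
  have hAB : Integrable (fun w => 2 * s * (A w * B w)) ν := (hA.integrable_mul hB).const_mul _
  have hB2 : Integrable (fun w => s ^ 2 * B w ^ 2) ν := hB.integrable_sq.const_mul _
  have hA2 : Integrable (fun w => A w ^ 2) ν := hA.integrable_sq
  have h1 : Integrable (fun w => A w ^ 2 - 2 * s * (A w * B w)) ν := hA2.sub hAB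
  rw [← integral_const_mul (2 * s), ← integral_const_mul (s ^ 2), ← integral_sub hA2 hAB,
    ← integral_add h1 hB2]
  refine integral_congr_ae (ae_of_all _ fun w => ?_)
  ring

/-- A minimizer of the second moment along a line is orthogonal to the direction of the line. -/
lemma integral_sq_sub_of_forall_le (hA : MemLp A 2 ν) (hB : MemLp B 2 ν)
    (h : ∀ s : ℝ, ∫ w, A w ^ 2 ∂ν ≤ ∫ w, (A w - s * B w) ^ 2 ∂ν) :
    ∫ w, (A w - B w) ^ 2 ∂ν = ∫ w, A w ^ 2 ∂ν + ∫ w, B w ^ 2 ∂ν := by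
  have horth : ∫ w, A w * B w ∂ν = 0 := by
    have h1 : ∀ s : ℝ, 0 ≤ (∫ w, B w ^ 2 ∂ν) * (s * s) + (-2 * ∫ w, A w * B w ∂ν) * s + 0 :=
      fun s => by
        have := h s
        rw [integral_sub_mul_sq hA hB] at this
        linarith
    -- The quadratic in s is nonnegative and has no constant term, so its discriminant is the square
    -- of the linear coefficient, which must vanish.
    have h2 := discrim_le_zero h1
    unfold discrim at h2
    nlinarith
  have h1 := integral_sub_mul_sq hA hB 1
  rw [horth] at h1
  simpa using h1

end L2

section Optimal

variable {e : EquationType} {P : ModelParams} {d : ℕ} {D : PDEData P.T d} {G : TimeGrid P.T}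
  {i : Fin G.N}

lemma TimeGrid.time_mem_Icc {T : ℝ} (G : TimeGrid T) (i : Fin G.N) : G.time i ∈ Set.Icc 0 T :=
  ⟨G.time_nonneg i, G.time_le i⟩

lemma pointLoss_eq (uNext u : (Fin d → ℝ) → ℝ) (z : (Fin d → ℝ) → Fin d → ℝ) (w : Sample d) :
    pointLoss e P D G i uNext u z w
      = (uNext (nextState e P (G.time i) (G.step i) w)
        - (D.implicitPart (G.time i) (G.step i) u z (state e P (G.time i) w)
          + ∑ k, z (state e P (G.time i) w) k * increment (G.step i) w k)) ^ 2 := rfl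

lemma admissible_iff {u : (Fin d → ℝ) → ℝ} {z : (Fin d → ℝ) → Fin d → ℝ} :
    Admissible e P G i u z ↔ Measurable u ∧ Measurable z ∧
      MemLp (fun w => u (state e P (G.time i) w)) 2 (sampleLaw d) ∧
      MemLp (fun w => norm2 (z (state e P (G.time i) w))) 2 (sampleLaw d) := by
  have hX := measurable_state e P (d := d) (G.time i)
  refine and_congr_right fun hu => and_congr_right fun hz => and_congr ?_ ?_
  · exact (memLp_two_iff_integrable_sq (hu.comp hX).aestronglyMeasurable).symm
  · exact (memLp_two_iff_integrable_sq
      (continuous_norm2.measurable.comp (hz.comp hX)).aestronglyMeasurable).symm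

lemma memLp_dominant (P : ModelParams) (hd : 1 ≤ d) :
    MemLp (fun w : Sample d => dominant P w) 2 (sampleLaw d) :=
  (memLp_two_iff_integrable_sq (measurable_dominant P).aestronglyMeasurable).2
    (integrable_dominant_pow P hd (by norm_num))

lemma norm2_state_le_dominant (w : Sample d) :
    norm2 (state e P (G.time i) w) ≤ dominant P w :=
  (norm2_le_norm1 _).trans
    (norm1_le_dominant (abs_state_le e (G.time_nonneg i) (G.time_le i) w))

lemma memLp_implicitPart (hd : 1 ≤ d) (hC : D.Cf * G.step i < 1) {u : (Fin d → ℝ) → ℝ}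
    {z : (Fin d → ℝ) → Fin d → ℝ} (h : Admissible e P G i u z) :
    MemLp (fun w => D.implicitPart (G.time i) (G.step i) u z (state e P (G.time i) w)) 2
      (sampleLaw d) := by
  have hX := measurable_state e P (d := d) (G.time i)
  obtain ⟨hu, hz, hu2, hz2⟩ := admissible_iff.1 h
  refine MemLp.mono (((memLp_const (|D.f (G.time i) 0 0 0| * G.step i)).add
    (memLp_dominant P hd)).add ((hu2.norm.const_mul 2).add hz2))
    ((D.measurable_implicitPart (G.time_mem_Icc i) hu hz).comp hX).aestronglyMeasurable
    (ae_of_all _ fun w => ?_)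
  have h1 := D.abs_f_mul_le (G.time_mem_Icc i) (G.step_pos i).le hC (state e P (G.time i) w)
    (u (state e P (G.time i) w)) (z (state e P (G.time i) w))
  have h2 := norm2_state_le_dominant (e := e) (P := P) (G := G) (i := i) w
  have h3 : D.Cf * G.step i * |u (state e P (G.time i) w)| ≤ |u (state e P (G.time i) w)| :=
    mul_le_of_le_one_left (abs_nonneg _) hC.le
  refine le_trans ?_ (le_abs_self _)
  simp only [PDEData.implicitPart, Real.norm_eq_abs, Pi.add_apply]
  refine (abs_sub _ _).trans ?_
  linarith

/-- From v = u - f Δ one gets (1 - C_f Δ)|u| ≤ |v| + |f(t,0,0,0)| Δ + |x| + |z|. The inverse factor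
may be large, but only square integrability is concluded, so it never reaches the final constants.
-/
lemma admissible_of_implicitPart (hd : 1 ≤ d) (hC : D.Cf * G.step i < 1) {u : (Fin d → ℝ) → ℝ}
    {z : (Fin d → ℝ) → Fin d → ℝ} (hu : Measurable u) (hz : Measurable z)
    (hv : MemLp (fun w => D.implicitPart (G.time i) (G.step i) u z (state e P (G.time i) w)) 2
      (sampleLaw d))
    (hz2 : MemLp (fun w => norm2 (z (state e P (G.time i) w))) 2 (sampleLaw d)) :
    Admissible e P G i u z := by
  have hX := measurable_state e P (d := d) (G.time i)
  refine admissible_iff.2 ⟨hu, hz, ?_, hz2⟩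
  refine MemLp.mono ((((memLp_const (|D.f (G.time i) 0 0 0| * G.step i)).add
    (memLp_dominant P hd)).add (hv.norm.add hz2)).const_mul (1 - D.Cf * G.step i)⁻¹)
    (hu.comp hX).aestronglyMeasurable (ae_of_all _ fun w => ?_)
  have h1 := D.abs_f_mul_le (G.time_mem_Icc i) (G.step_pos i).le hC (state e P (G.time i) w)
    (u (state e P (G.time i) w)) (z (state e P (G.time i) w))
  have h2 := norm2_state_le_dominant (e := e) (P := P) (G := G) (i := i) w
  refine le_trans ?_ (le_abs_self _)
  simp only [PDEData.implicitPart, Real.norm_eq_abs, Pi.add_apply]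
  rw [inv_mul_eq_div, le_div_iff₀ (by linarith)]
  have h3 := abs_add_le (u (state e P (G.time i) w) - D.f (G.time i) (state e P (G.time i) w)
    (u (state e P (G.time i) w)) (z (state e P (G.time i) w)) * G.step i)
    (D.f (G.time i) (state e P (G.time i) w)
    (u (state e P (G.time i) w)) (z (state e P (G.time i) w)) * G.step i)
  rw [sub_add_cancel] at h3
  linarith

lemma exists_admissible_implicitPart_eq (hd : 1 ≤ d) (hC : D.Cf * G.step i < 1)
    {v : (Fin d → ℝ) → ℝ} {z : (Fin d → ℝ) → Fin d → ℝ} (hv : Measurable v) (hz : Measurable z)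
    (hv2 : MemLp (fun w => v (state e P (G.time i) w)) 2 (sampleLaw d))
    (hz2 : MemLp (fun w => norm2 (z (state e P (G.time i) w))) 2 (sampleLaw d)) :
    ∃ u, Admissible e P G i u z ∧ D.implicitPart (G.time i) (G.step i) u z = v := by
  obtain ⟨u, hu, rfl⟩ := D.exists_implicitPart_eq (G.time_mem_Icc i) (G.step_pos i).le hC hv hz
  exact ⟨u, admissible_of_implicitPart hd hC hu hz hv2 hz2, rfl⟩

lemma integral_sq_dot_increment_le {z : (Fin d → ℝ) → Fin d → ℝ} (hz : Measurable z)
    (hz2 : MemLp (fun w => norm2 (z (state e P (G.time i) w))) 2 (sampleLaw d)) :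
    MemLp (fun w => ∑ k, z (state e P (G.time i) w) k * increment (G.step i) w k) 2
        (sampleLaw d) ∧
      ∫ w, (∑ k, z (state e P (G.time i) w) k * increment (G.step i) w k) ^ 2 ∂(sampleLaw d)
        ≤ (d * P.T) * ∫ w, norm2 (z (state e P (G.time i) w)) ^ 2 ∂(sampleLaw d) := by
  have hX := measurable_state e P (d := d) (G.time i)
  have hI := measurable_increment (d := d) (G.step i)
  obtain ⟨h1, h2⟩ := integral_mul_norm2_increment_sq e P (G.time i) (G.step_pos i).le
    (φ := fun x => norm2 (z x) ^ 2) ((continuous_norm2.measurable.comp hz).pow_const 2)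
    hz2.integrable_sq
  have hm : Measurable fun w : Sample d =>
      ∑ k, z (state e P (G.time i) w) k * increment (G.step i) w k :=
    Finset.measurable_sum _ fun k _ => ((measurable_pi_apply k).comp (hz.comp hX)).mul
      ((measurable_pi_apply k).comp hI)
  have h3 : Integrable (fun w => (∑ k, z (state e P (G.time i) w) k
      * increment (G.step i) w k) ^ 2) (sampleLaw d) :=
    h1.mono' (hm.pow_const 2).aestronglyMeasurable (ae_of_all _ fun w => by
      rw [Real.norm_of_nonneg (sq_nonneg _)]
      exact sq_dot_le _ _)
  refine ⟨(memLp_two_iff_integrable_sq hm.aestronglyMeasurable).2 h3, ?_⟩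
  refine (integral_mono h3 h1 fun w => sq_dot_le _ _).trans ?_
  rw [h2, mul_comm]
  have := G.step_le i
  have : 0 ≤ ∫ w, norm2 (z (state e P (G.time i) w)) ^ 2 ∂(sampleLaw d) :=
    integral_nonneg fun w => sq_nonneg _
  gcongr

lemma memLp_norm2_of_le {z z₁ z₂ : (Fin d → ℝ) → Fin d → ℝ} (hz : Measurable z) {s : ℝ}
    (h₁ : MemLp (fun w => norm2 (z₁ (state e P (G.time i) w))) 2 (sampleLaw d))
    (h₂ : MemLp (fun w => norm2 (z₂ (state e P (G.time i) w))) 2 (sampleLaw d))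
    (h : ∀ x, norm2 (z x) ≤ norm2 (z₁ x) + s * norm2 (z₂ x)) :
    MemLp (fun w => norm2 (z (state e P (G.time i) w))) 2 (sampleLaw d) :=
  MemLp.mono (h₁.add (h₂.const_mul s)) (continuous_norm2.measurable.comp
    (hz.comp (measurable_state e P (d := d) (G.time i)))).aestronglyMeasurable
    (ae_of_all _ fun w => by
      rw [Real.norm_of_nonneg (norm2_nonneg _)]
      exact (h _).trans (le_abs_self _))

/-- The loss of an admissible pair exceeds the optimal loss by the second moment of the
perturbation of the linear part of the residual, since the optimal residual is orthogonal to all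
perturbations. -/
lemma loss_eq_loss_optimal_add (hd : 1 ≤ d) (hC : D.Cf * G.step i < 1) {uNext : (Fin d → ℝ) → ℝ}
    (hNext : MemLp (fun w => uNext (nextState e P (G.time i) (G.step i) w)) 2 (sampleLaw d))
    {uo u : (Fin d → ℝ) → ℝ} {zo z : (Fin d → ℝ) → Fin d → ℝ}
    (hopt : IsOptimalPair e P D G i uNext uo zo) (h : Admissible e P G i u z) :
    loss e P D G i uNext u z = loss e P D G i uNext uo zo
      + ∫ w, (D.implicitPart (G.time i) (G.step i) u z (state e P (G.time i) w)
          - D.implicitPart (G.time i) (G.step i) uo zo (state e P (G.time i) w)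
          + ∑ k, (z (state e P (G.time i) w) - zo (state e P (G.time i) w)) k
            * increment (G.step i) w k) ^ 2 ∂(sampleLaw d) := by
  obtain ⟨ho, hmin⟩ := hopt
  have hvo2 := memLp_implicitPart hd hC ho
  have hv2 := memLp_implicitPart hd hC h
  obtain ⟨huo, hzo, huo2, hzo2⟩ := admissible_iff.1 ho
  obtain ⟨hu, hz, hu2, hz2⟩ := admissible_iff.1 h
  have ht := G.time_mem_Icc i
  have hvo := D.measurable_implicitPart (Δ := G.step i) ht huo hzo
  have hv := D.measurable_implicitPart (Δ := G.step i) ht hu hz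
  set vo := D.implicitPart (G.time i) (G.step i) uo zo with hvodef
  set v := D.implicitPart (G.time i) (G.step i) u z with hvdef
  set A : Sample d → ℝ := fun w => uNext (nextState e P (G.time i) (G.step i) w)
    - (vo (state e P (G.time i) w)
      + ∑ k, zo (state e P (G.time i) w) k * increment (G.step i) w k) with hA
  set B : Sample d → ℝ := fun w => v (state e P (G.time i) w) - vo (state e P (G.time i) w)
    + ∑ k, (z (state e P (G.time i) w) - zo (state e P (G.time i) w)) k
      * increment (G.step i) w k with hB
  have hψ : MemLp (fun w => norm2 ((fun x => z x - zo x) (state e P (G.time i) w))) 2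
      (sampleLaw d) :=
    memLp_norm2_of_le (z := fun x => z x - zo x) (s := 1) (hz.sub hzo) hz2 hzo2 fun x => by
      simpa using norm2_sub_le (z x) (zo x)
  have hA2 : MemLp A 2 (sampleLaw d) :=
    hNext.sub (hvo2.add (integral_sq_dot_increment_le hzo hzo2).1)
  have hB2 : MemLp B 2 (sampleLaw d) :=
    (hv2.sub hvo2).add (integral_sq_dot_increment_le (hz.sub hzo) hψ).1
  -- Along the segment from the optimal pair in the coordinates (v, z) the residual is affine in s;
  -- s = 1 recovers the given pair.
  have hdot : ∀ (s : ℝ) w, (uNext (nextState e P (G.time i) (G.step i) w)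
      - ((vo (state e P (G.time i) w)
        + s * (v (state e P (G.time i) w) - vo (state e P (G.time i) w)))
      + ∑ k, (zo (state e P (G.time i) w)
        + s • (z (state e P (G.time i) w) - zo (state e P (G.time i) w))) k
        * increment (G.step i) w k)) = A w - s * B w := fun s w => by
    simp only [hA, hB, Pi.add_apply, Pi.smul_apply, smul_eq_mul, add_mul, Finset.sum_add_distrib,
      mul_assoc, ← Finset.mul_sum]
    ring
  have hvar : ∀ s : ℝ, ∫ w, A w ^ 2 ∂(sampleLaw d) ≤ ∫ w, (A w - s * B w) ^ 2 ∂(sampleLaw d) := by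
    intro s
    -- The point of the line is pulled back to an admissible pair (u, z) by solving the implicit
    -- equation, so optimality can be applied to it.
    obtain ⟨us, hadm, hus⟩ := exists_admissible_implicitPart_eq (e := e) (i := i) hd hC
      (hvo.add ((hv.sub hvo).const_mul s)) (hzo.add ((hz.sub hzo).const_smul s))
      (hvo2.add ((hv2.sub hvo2).const_mul s))
      (memLp_norm2_of_le (z₁ := zo) (z₂ := fun x => z x - zo x) (s := |s|)
        (hzo.add ((hz.sub hzo).const_smul s)) hzo2 hψ fun x => by
          rw [← norm2_smul]
          exact norm2_add_le _ _)
    refine (hmin us _ hadm).trans_eq ?_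
    unfold loss
    refine integral_congr_ae (ae_of_all _ fun w => ?_)
    simp only [pointLoss_eq, hus]
    exact congrArg (· ^ 2) (hdot s w)
  refine Eq.trans ?_ (integral_sq_sub_of_forall_le hA2 hB2 hvar)
  unfold loss
  refine integral_congr_ae (ae_of_all _ fun w => ?_)
  have h1 := hdot 1 w
  simp only [one_mul, one_smul, add_sub_cancel] at h1
  exact congrArg (· ^ 2) h1

/-- Because C_f Δ < 1, the perturbation of v is at most 2|u - u*| + |z - z*|. Squaring three terms
gives the weights 12, 3, 3, and the stochastic term has second moment at most dT E|z - z*|² by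
independence; 3(5 + Td) dominates both resulting coefficients. -/
lemma loss_sub_loss_optimal_le (hd : 1 ≤ d) (hC : D.Cf * G.step i < 1) {uNext : (Fin d → ℝ) → ℝ}
    (hNext : MemLp (fun w => uNext (nextState e P (G.time i) (G.step i) w)) 2 (sampleLaw d))
    {uo u : (Fin d → ℝ) → ℝ} {zo z : (Fin d → ℝ) → Fin d → ℝ}
    (hopt : IsOptimalPair e P D G i uNext uo zo) (h : Admissible e P G i u z) :
    loss e P D G i uNext u z - loss e P D G i uNext uo zo
      ≤ 3 * (5 + P.T * d) * approxError e P G i uo u zo z := by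
  rw [loss_eq_loss_optimal_add hd hC hNext hopt h, add_sub_cancel_left]
  obtain ⟨huo, hzo, huo2, hzo2⟩ := admissible_iff.1 hopt.1
  obtain ⟨hu, hz, hu2, hz2⟩ := admissible_iff.1 h
  have ht := G.time_mem_Icc i
  have hψ : MemLp (fun w => norm2 ((fun x => z x - zo x) (state e P (G.time i) w))) 2
      (sampleLaw d) :=
    memLp_norm2_of_le (z := fun x => z x - zo x) (s := 1) (hz.sub hzo) hz2 hzo2 fun x => by
      simpa using norm2_sub_le (z x) (zo x)
  obtain ⟨hdot2, hdot⟩ := integral_sq_dot_increment_le (hz.sub hzo) hψ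
  have hφ := (hu2.sub huo2).integrable_sq
  have hψ' := hψ.integrable_sq
  have hdot2' := hdot2.integrable_sq
  simp only [Pi.sub_apply] at hφ hψ' hdot hdot2'
  have hpt : ∀ w, (D.implicitPart (G.time i) (G.step i) u z (state e P (G.time i) w)
          - D.implicitPart (G.time i) (G.step i) uo zo (state e P (G.time i) w)
          + ∑ k, (z (state e P (G.time i) w) - zo (state e P (G.time i) w)) k
            * increment (G.step i) w k) ^ 2
      ≤ 12 * (u (state e P (G.time i) w) - uo (state e P (G.time i) w)) ^ 2
        + 3 * norm2 (z (state e P (G.time i) w) - zo (state e P (G.time i) w)) ^ 2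
        + 3 * (∑ k, (z (state e P (G.time i) w) k - zo (state e P (G.time i) w) k)
            * increment (G.step i) w k) ^ 2 := by
    intro w
    have hf := D.abs_f_sub_le ht (state e P (G.time i) w) (state e P (G.time i) w)
      (u (state e P (G.time i) w)) (uo (state e P (G.time i) w))
      (z (state e P (G.time i) w)) (zo (state e P (G.time i) w))
    simp only [PDEData.implicitPart, Pi.sub_apply]
    set X := state e P (G.time i) w
    set q := ∑ k, (z X k - zo X k) * increment (G.step i) w k
    set n := norm2 (z X - zo X) with hn
    have hn0 : 0 ≤ n := norm2_nonneg _
    have hΔ := (G.step_pos i).le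
    rw [sub_self, norm2_zero, zero_add] at hf
    have h1 : |(D.f (G.time i) X (u X) (z X) - D.f (G.time i) X (uo X) (zo X)) * G.step i|
        ≤ |u X - uo X| + n := by
      rw [abs_mul, abs_of_nonneg hΔ]
      calc _ ≤ D.Cf * (|u X - uo X| + n) * G.step i := by gcongr
        _ = (D.Cf * G.step i) * (|u X - uo X| + n) := by ring
        _ ≤ 1 * (|u X - uo X| + n) := by gcongr
        _ = _ := one_mul _
    have h2 : |u X - D.f (G.time i) X (u X) (z X) * G.step i
        - (uo X - D.f (G.time i) X (uo X) (zo X) * G.step i) + q|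
        ≤ 2 * |u X - uo X| + n + |q| := by
      have e1 : u X - D.f (G.time i) X (u X) (z X) * G.step i
        - (uo X - D.f (G.time i) X (uo X) (zo X) * G.step i) + q = (u X - uo X)
        - (D.f (G.time i) X (u X) (z X) - D.f (G.time i) X (uo X) (zo X)) * G.step i + q := by
        ring
      rw [e1]
      refine (abs_add_le _ _).trans ?_
      have := abs_sub (u X - uo X)
        ((D.f (G.time i) X (u X) (z X) - D.f (G.time i) X (uo X) (zo X)) * G.step i)
      linarith
    have h3 := pow_le_pow_left₀ (abs_nonneg _) h2 2
    rw [sq_abs] at h3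
    refine h3.trans ?_
    rw [← sq_abs (u X - uo X), ← sq_abs q]
    nlinarith [sq_nonneg (2 * |u X - uo X| - n), sq_nonneg (2 * |u X - uo X| - |q|),
      sq_nonneg (n - |q|)]
  have hI1 : Integrable (fun w => 12 * (u (state e P (G.time i) w)
      - uo (state e P (G.time i) w)) ^ 2) (sampleLaw d) := hφ.const_mul 12
  have hI2 : Integrable (fun w => 3 * norm2 (z (state e P (G.time i) w)
      - zo (state e P (G.time i) w)) ^ 2) (sampleLaw d) := hψ'.const_mul 3
  have hI3 : Integrable (fun w => 3 * (∑ k, (z (state e P (G.time i) w) k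
      - zo (state e P (G.time i) w) k) * increment (G.step i) w k) ^ 2) (sampleLaw d) :=
    hdot2'.const_mul 3
  have hI12 := hI1.add hI2
  refine (integral_mono_of_nonneg (ae_of_all _ fun w => sq_nonneg _) (hI12.add hI3)
    (ae_of_all _ hpt)).trans ?_
  rw [integral_add' hI12 hI3, integral_add' hI1 hI2, integral_const_mul, integral_const_mul,
    integral_const_mul]
  have e1 : approxError e P G i uo u zo z
      = ∫ w, (u (state e P (G.time i) w) - uo (state e P (G.time i) w)) ^ 2 ∂(sampleLaw d) +
        ∫ w, norm2 (z (state e P (G.time i) w) - zo (state e P (G.time i) w)) ^ 2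
          ∂(sampleLaw d) := by
    unfold approxError
    simp_rw [norm2_sq, Pi.sub_apply, sub_sq_comm (u _), fun (x : Fin d → ℝ) k =>
      sub_sq_comm (z x k) (zo x k)]
  rw [e1]
  have h1 : 0 ≤ ∫ w, (u (state e P (G.time i) w) - uo (state e P (G.time i) w)) ^ 2
      ∂(sampleLaw d) := integral_nonneg fun _ => sq_nonneg _
  have h2 : 0 ≤ ∫ w, norm2 (z (state e P (G.time i) w) - zo (state e P (G.time i) w)) ^ 2
      ∂(sampleLaw d) := integral_nonneg fun _ => sq_nonneg _
  have h3 : 0 ≤ P.T * d := mul_nonneg P.T_pos.le d.cast_nonneg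
  nlinarith [mul_nonneg h3 h1]

end Optimal

/-! ### Pathwise bounds for the integrand -/

lemma PDEData.Cfg_nonneg {T : ℝ} {d : ℕ} (D : PDEData T d) : 0 ≤ D.Cfg :=
  (sq_nonneg D.Cf).trans (le_max_left _ _)

/-- The bound 1 + C replaces √C, which would not be polynomial in C_{fg}. -/
lemma abs_le_one_add_of_sq_le {x C : ℝ} (h : x ^ 2 ≤ C) : |x| ≤ 1 + C := by
  nlinarith [sq_abs x, sq_nonneg (|x| - 1), abs_nonneg x]

lemma PDEData.Cg_le {T : ℝ} {d : ℕ} (D : PDEData T d) : D.Cg ≤ 1 + D.Cfg :=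
  (le_abs_self _).trans (abs_le_one_add_of_sq_le ((le_max_left _ _).trans (le_max_right _ _)))

lemma PDEData.abs_f_zero_le {T : ℝ} {d : ℕ} (D : PDEData T d) : |D.f 0 0 0 0| ≤ 1 + D.Cfg :=
  abs_le_one_add_of_sq_le ((le_max_left _ _).trans ((le_max_right _ _).trans (le_max_right _ _)))

lemma PDEData.abs_g_zero_le {T : ℝ} {d : ℕ} (D : PDEData T d) : |D.g 0| ≤ 1 + D.Cfg :=
  abs_le_one_add_of_sq_le ((le_max_right _ _).trans ((le_max_right _ _).trans (le_max_right _ _)))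

/-- The Hölder condition in time moves the base point to t = 0. The factor C_f is absorbed by Δ,
leaving √t ≤ 1 + T. -/
lemma PDEData.abs_f_time_mul_le {T : ℝ} {d : ℕ} (D : PDEData T d) {t Δ : ℝ}
    (ht : t ∈ Set.Icc 0 T) (hΔ : 0 ≤ Δ) (hΔT : Δ ≤ T) (hC : D.Cf * Δ < 1) :
    |D.f t 0 0 0| * Δ ≤ 2 * ((1 + T) * (1 + D.Cfg)) := by
  have hT : 0 ≤ T := hΔ.trans hΔT
  have h := D.f_lip t ht 0 ⟨le_rfl, hT⟩ 0 0 0 0 0 0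
  simp only [sub_self, norm2_zero, abs_zero, add_zero, sub_zero, abs_of_nonneg ht.1] at h
  have h1 := abs_sub_abs_le_abs_sub (D.f t 0 0 0) (D.f 0 0 0 0)
  have h2 : √t ≤ 1 + T := by
    refine Real.sqrt_le_iff.2 ⟨by linarith, ?_⟩
    nlinarith [ht.2]
  have h3 := D.abs_f_zero_le
  have h4 := D.Cfg_nonneg
  have h5 := Real.sqrt_nonneg t
  calc |D.f t 0 0 0| * Δ ≤ ((1 + D.Cfg) + D.Cf * √t) * Δ := by gcongr; linarith
    _ = (1 + D.Cfg) * Δ + (D.Cf * Δ) * √t := by ring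
    _ ≤ (1 + D.Cfg) * T + 1 * (1 + T) := by gcongr
    _ ≤ _ := by nlinarith

section Pathwise

variable {e : EquationType} {P : ModelParams} {d : ℕ} {D : PDEData P.T d} {G : TimeGrid P.T}
  {i : Fin G.N} {H : List ℕ} {S : ℝ}

/-- The common size bound of the two networks and the bound of the parameters that the following
lemmas need. -/
structure NetBounds (d : ℕ) (H : List ℕ) (S : ℝ) : Prop where
  one_le : 1 ≤ S
  depth_le : (depth H : ℝ) ≤ S
  sizes_U : SizesLe d H 1 S
  sizes_Z : SizesLe d H d S

lemma norm1_state_add_one_le (hd : 1 ≤ d) (w : Sample d) :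
    norm1 (state e P (G.time i) w) + 1 ≤ 2 * dominant P w := by
  have h1 := norm1_le_dominant (abs_state_le e (G.time_nonneg i) (G.time_le i) w)
  linarith [one_le_dominant P hd w]

lemma abs_netU_state_le (hS : NetBounds d H S) (hd : 1 ≤ d) {ϑ : Params d H 1} (hϑ : ‖ϑ‖ ≤ S)
    (w : Sample d) : |netU ϑ (state e P (G.time i) w)| ≤ 4 * S ^ 2 * dominant P w := by
  have h1 := abs_network_le hS.one_le hS.sizes_U hϑ (state e P (G.time i) w) 0
  have h2 := norm1_state_add_one_le (e := e) (P := P) (G := G) (i := i) hd w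
  calc _ ≤ 2 * S ^ 2 * (norm1 (state e P (G.time i) w) + 1) := h1
    _ ≤ 2 * S ^ 2 * (2 * dominant P w) := by gcongr
    _ = _ := by ring

lemma abs_netZ_state_le (hS : NetBounds d H S) (hd : 1 ≤ d) {ϑ : Params d H d} (hϑ : ‖ϑ‖ ≤ S)
    (w : Sample d) (k : Fin d) :
    |netZ ϑ (state e P (G.time i) w) k| ≤ 4 * S ^ 2 * dominant P w := by
  have h1 := abs_network_le hS.one_le hS.sizes_Z hϑ (state e P (G.time i) w) k
  have h2 := norm1_state_add_one_le (e := e) (P := P) (G := G) (i := i) hd w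
  calc _ ≤ 2 * S ^ 2 * (norm1 (state e P (G.time i) w) + 1) := h1
    _ ≤ 2 * S ^ 2 * (2 * dominant P w) := by gcongr
    _ = _ := by ring

lemma norm2_netZ_state_le (hS : NetBounds d H S) (hd : 1 ≤ d) {ϑ : Params d H d} (hϑ : ‖ϑ‖ ≤ S)
    (w : Sample d) : norm2 (netZ ϑ (state e P (G.time i) w)) ≤ 4 * S ^ 3 * dominant P w := by
  refine (norm2_le_norm1 _).trans
    ((norm1_le_of_abs_le (abs_netZ_state_le (e := e) (i := i) hS hd hϑ w)).trans ?_)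
  have := one_le_dominant P hd w
  have := hS.sizes_U.1
  calc (d : ℝ) * (4 * S ^ 2 * dominant P w) ≤ S * (4 * S ^ 2 * dominant P w) := by gcongr
    _ = _ := by ring

lemma abs_dot_le {x y : Fin d → ℝ} {C : ℝ} (hx : ∀ k, |x k| ≤ C) :
    |∑ k, x k * y k| ≤ C * norm1 y := by
  refine (Finset.abs_sum_le_sum_abs _ _).trans ?_
  rw [norm1, Finset.mul_sum]
  refine Finset.sum_le_sum fun k _ => ?_
  rw [abs_mul]
  exact mul_le_mul_of_nonneg_right (hx k) (abs_nonneg _)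

/-- The constant in the growth bound of the residual. -/
noncomputable def residualBound (T C S : ℝ) : ℝ := 25 * ((1 + T) * (1 + C)) * S ^ 3

lemma one_le_residualBound {T C : ℝ} (hT : 0 ≤ T) (hC : 0 ≤ C) (hS : 1 ≤ S) :
    1 ≤ residualBound T C S := by
  have h1 : 1 ≤ S ^ 3 := one_le_pow₀ hS
  have h2 : 1 ≤ (1 + T) * (1 + C) := by nlinarith
  unfold residualBound
  nlinarith

/-- The residual whose square is the integrand. -/
noncomputable def residual (e : EquationType) (P : ModelParams) {d : ℕ} (D : PDEData P.T d) (G : TimeGrid P.T)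
    (i : Fin G.N) (uNext u : (Fin d → ℝ) → ℝ) (z : (Fin d → ℝ) → Fin d → ℝ) (w : Sample d) : ℝ :=
  uNext (nextState e P (G.time i) (G.step i) w)
    - (D.implicitPart (G.time i) (G.step i) u z (state e P (G.time i) w)
      + ∑ k, z (state e P (G.time i) w) k * increment (G.step i) w k)

lemma abs_uNext_le (hd : 1 ≤ d) {uNext : (Fin d → ℝ) → ℝ} {C : ℝ} (hC0 : 0 ≤ C)
    (hN : ∀ x, |uNext x| ≤ C * (norm1 x + 1)) (w : Sample d) :
    |uNext (nextState e P (G.time i) (G.step i) w)| ≤ 2 * C * dominant P w := by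
  have h1 := norm1_le_dominant (abs_nextState_le e (G.time_nonneg i) (G.time_le i)
    (G.step_pos i).le (G.step_le i) w)
  have h2 := one_le_dominant P hd w
  calc _ ≤ C * (norm1 (nextState e P (G.time i) (G.step i) w) + 1) := hN _
    _ ≤ C * (2 * dominant P w) := by gcongr; linarith
    _ = _ := by ring

lemma abs_residual_le (hS : NetBounds d H S) (hd : 1 ≤ d) (hC : D.Cf * G.step i < 1)
    {uNext : (Fin d → ℝ) → ℝ} (hN : ∀ x, |uNext x| ≤ 2 * (1 + D.Cfg) * S ^ 2 * (norm1 x + 1))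
    {θ : PairParams d H} (hθ : ‖θ‖ ≤ S) (w : Sample d) :
    |residual e P D G i uNext (netU θ.1) (netZ θ.2) w|
      ≤ residualBound P.T D.Cfg S * dominant P w ^ 2 := by
  have hS1 := hS.one_le
  have hθ1 : ‖θ.1‖ ≤ S := (norm_fst_le θ).trans hθ
  have hθ2 : ‖θ.2‖ ≤ S := (norm_snd_le θ).trans hθ
  have hCfg := D.Cfg_nonneg
  have hT := P.T_pos.le
  have hf := D.abs_f_mul_le (G.time_mem_Icc i) (G.step_pos i).le hC (state e P (G.time i) w)
    (netU θ.1 (state e P (G.time i) w)) (netZ θ.2 (state e P (G.time i) w))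
  have hf0 := D.abs_f_time_mul_le (G.time_mem_Icc i) (G.step_pos i).le (G.step_le i) hC
  have hX := norm2_state_le_dominant (e := e) (P := P) (G := G) (i := i) w
  have hu := abs_netU_state_le (e := e) (P := P) (G := G) (i := i) hS hd hθ1 w
  have hz := norm2_netZ_state_le (e := e) (P := P) (G := G) (i := i) hS hd hθ2 w
  have hzk := abs_netZ_state_le (e := e) (P := P) (G := G) (i := i) hS hd hθ2 w
  have hI := norm1_le_dominant (abs_increment_le (G.step_le i) w)
  have hU := abs_uNext_le (e := e) (P := P) (G := G) (i := i) hd (by positivity) hN w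
  have hdot : |∑ k, netZ θ.2 (state e P (G.time i) w) k * increment (G.step i) w k|
      ≤ 4 * S ^ 2 * dominant P w * dominant P w := by
    have := one_le_dominant P hd w
    exact (abs_dot_le hzk).trans (by gcongr)
  have hρ := one_le_dominant P hd w
  have h1 : D.Cf * G.step i * |netU θ.1 (state e P (G.time i) w)|
      ≤ |netU θ.1 (state e P (G.time i) w)| := mul_le_of_le_one_left (abs_nonneg _) hC.le
  have htri : |residual e P D G i uNext (netU θ.1) (netZ θ.2) w|
      ≤ |uNext (nextState e P (G.time i) (G.step i) w)| + |netU θ.1 (state e P (G.time i) w)|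
        + |D.f (G.time i) (state e P (G.time i) w) (netU θ.1 (state e P (G.time i) w))
          (netZ θ.2 (state e P (G.time i) w)) * G.step i|
        + |∑ k, netZ θ.2 (state e P (G.time i) w) k * increment (G.step i) w k| := by
    unfold residual PDEData.implicitPart
    refine (abs_sub _ _).trans ?_
    have := abs_add_le (netU θ.1 (state e P (G.time i) w) - D.f (G.time i)
      (state e P (G.time i) w) (netU θ.1 (state e P (G.time i) w))
      (netZ θ.2 (state e P (G.time i) w)) * G.step i)
      (∑ k, netZ θ.2 (state e P (G.time i) w) k * increment (G.step i) w k)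
    have := abs_sub (netU θ.1 (state e P (G.time i) w)) (D.f (G.time i)
      (state e P (G.time i) w) (netU θ.1 (state e P (G.time i) w))
      (netZ θ.2 (state e P (G.time i) w)) * G.step i)
    linarith
  unfold residualBound
  set ρ := dominant P w
  set c := (1 + P.T) * (1 + D.Cfg) with hc
  have hc1 : 1 ≤ c := by nlinarith
  have hcC : 1 + D.Cfg ≤ c := by nlinarith
  have hS23 : S ^ 2 ≤ S ^ 3 := pow_le_pow_right₀ hS1 (by norm_num)
  have hS3 : 1 ≤ S ^ 3 := one_le_pow₀ hS1
  have hρ2 : ρ ≤ ρ ^ 2 := by nlinarith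
  have hρ1 : 1 ≤ ρ ^ 2 := one_le_pow₀ hρ
  have hS0 : 0 ≤ S := by linarith
  -- Every contribution is a multiple of c S³ ρ². The multiples are 4 for the next value, 4 for u, 2
  -- + 1 + 4 + 4 for the nonlinearity and 4 for the stochastic term: 23 in all, below the 25 in
  -- `residualBound`.
  have q1 : (1 + D.Cfg) * S ^ 2 * ρ ≤ c * S ^ 3 * ρ ^ 2 := by gcongr
  have q2 : 1 * S ^ 2 * ρ ≤ c * S ^ 3 * ρ ^ 2 := by gcongr
  have q3 : c * 1 * 1 ≤ c * S ^ 3 * ρ ^ 2 := by gcongr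
  have q4 : 1 * 1 * ρ ≤ c * S ^ 3 * ρ ^ 2 := by gcongr
  have q5 : 1 * S ^ 3 * ρ ≤ c * S ^ 3 * ρ ^ 2 := by gcongr
  have q6 : 1 * S ^ 2 * ρ ^ 2 ≤ c * S ^ 3 * ρ ^ 2 := by gcongr
  linarith

lemma norm1_zero : norm1 (0 : Fin d → ℝ) = 0 := by simp [norm1]

lemma abs_network_state_sub_le (hS : NetBounds d H S) (hd : 1 ≤ d) {b : ℕ} (hs : SizesLe d H b S)
    {ϑ ϑ' : Params d H b} (hϑ : ‖ϑ‖ ≤ S) (w : Sample d) (k : Fin b) :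
    |network d H b ϑ (state e P (G.time i) w) k - network d H b ϑ' (state e P (G.time i) w) k|
      ≤ 2 * (3 * S ^ 2) ^ depth H * ‖ϑ - ϑ'‖ * dominant P w := by
  have h1 := abs_network_sub_le hS.one_le d H b hs ϑ ϑ' hϑ (state e P (G.time i) w)
    (state e P (G.time i) w) k
  have h2 := norm1_state_add_one_le (e := e) (P := P) (G := G) (i := i) hd w
  have hS1 := hS.one_le
  -- This merges the factor S of the last layer into the power, so the exponent becomes the depth,
  -- one more than the number of hidden layers.
  have h3 : S ≤ 3 * S ^ 2 := by nlinarith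
  rw [sub_self, norm1_zero, zero_add] at h1
  calc _ ≤ _ := h1
    _ ≤ (3 * S ^ 2 * (3 * S ^ 2) ^ H.length) * (‖ϑ - ϑ'‖ * (2 * dominant P w)) := by
      have := norm1_nonneg (state e P (G.time i) w)
      gcongr
    _ = _ := by
      rw [depth, pow_succ]
      ring

lemma abs_residual_sub_le (hS : NetBounds d H S) (hd : 1 ≤ d) (hC : D.Cf * G.step i < 1)
    {uNext : (Fin d → ℝ) → ℝ} {θ θ' : PairParams d H} (hθ : ‖θ‖ ≤ S) (w : Sample d) :
    |residual e P D G i uNext (netU θ.1) (netZ θ.2) w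
        - residual e P D G i uNext (netU θ'.1) (netZ θ'.2) w|
      ≤ 8 * (3 * S ^ 2) ^ depth H * S * ‖θ - θ'‖ * dominant P w ^ 2 := by
  have hS1 := hS.one_le
  have hρ := one_le_dominant P hd w
  have hη0 := norm_nonneg (θ - θ')
  have hu := abs_network_state_sub_le (e := e) (P := P) (G := G) (i := i) (ϑ' := θ'.1) hS hd
    hS.sizes_U ((norm_fst_le θ).trans hθ) w 0
  have hz := abs_network_state_sub_le (e := e) (P := P) (G := G) (i := i) (ϑ' := θ'.2) hS hd
    hS.sizes_Z ((norm_snd_le θ).trans hθ) w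
  have hf := D.abs_f_sub_le (G.time_mem_Icc i) (state e P (G.time i) w) (state e P (G.time i) w)
    (netU θ.1 (state e P (G.time i) w)) (netU θ'.1 (state e P (G.time i) w))
    (netZ θ.2 (state e P (G.time i) w)) (netZ θ'.2 (state e P (G.time i) w))
  have hI := norm1_le_dominant (abs_increment_le (G.step_le i) w)
  have hdS := hS.sizes_U.1
  rw [sub_self, norm2_zero, zero_add] at hf
  set X := state e P (G.time i) w
  set ρ := dominant P w
  set B := (3 * S ^ 2) ^ depth H
  set η := ‖θ - θ'‖
  have hB : 0 ≤ B := by positivity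
  have hu' : |netU θ.1 X - netU θ'.1 X| ≤ 2 * B * η * ρ := by
    refine hu.trans ?_
    gcongr
    exact norm_fst_le (θ - θ')
  have hz' : ∀ k, |(netZ θ.2 X - netZ θ'.2 X) k| ≤ 2 * B * η * ρ := fun k => by
    refine (hz k).trans ?_
    gcongr
    exact norm_snd_le (θ - θ')
  have hz2 : norm2 (netZ θ.2 X - netZ θ'.2 X) ≤ S * (2 * B * η * ρ) :=
    (norm2_le_norm1 _).trans ((norm1_le_of_abs_le hz').trans (by gcongr))
  have hdot : |∑ k, (netZ θ.2 X - netZ θ'.2 X) k * increment (G.step i) w k|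
      ≤ 2 * B * η * ρ * ρ := (abs_dot_le hz').trans (by gcongr)
  have hf' : |(D.f (G.time i) X (netU θ.1 X) (netZ θ.2 X)
      - D.f (G.time i) X (netU θ'.1 X) (netZ θ'.2 X)) * G.step i|
      ≤ 2 * B * η * ρ + S * (2 * B * η * ρ) := by
    have hΔ := (G.step_pos i).le
    have hn := norm2_nonneg (netZ θ.2 X - netZ θ'.2 X)
    rw [abs_mul, abs_of_nonneg hΔ]
    calc _ ≤ D.Cf * (|netU θ.1 X - netU θ'.1 X| + norm2 (netZ θ.2 X - netZ θ'.2 X))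
          * G.step i := by gcongr
      _ = (D.Cf * G.step i)
          * (|netU θ.1 X - netU θ'.1 X| + norm2 (netZ θ.2 X - netZ θ'.2 X)) := by ring
      _ ≤ 1 * (|netU θ.1 X - netU θ'.1 X| + norm2 (netZ θ.2 X - netZ θ'.2 X)) := by gcongr
      _ ≤ _ := by linarith
  have hsplit : residual e P D G i uNext (netU θ.1) (netZ θ.2) w
        - residual e P D G i uNext (netU θ'.1) (netZ θ'.2) w
      = -(netU θ.1 X - netU θ'.1 X) + (D.f (G.time i) X (netU θ.1 X) (netZ θ.2 X)
      - D.f (G.time i) X (netU θ'.1 X) (netZ θ'.2 X)) * G.step i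
      + -(∑ k, (netZ θ.2 X - netZ θ'.2 X) k * increment (G.step i) w k) := by
    simp only [residual, PDEData.implicitPart, Pi.sub_apply, sub_mul, Finset.sum_sub_distrib]
    ring
  rw [hsplit]
  refine (abs_add_three _ _ _).trans ?_
  rw [abs_neg, abs_neg]
  have hρ2 : ρ ≤ ρ ^ 2 := by nlinarith
  have q1 : B * 1 * η * ρ ≤ B * S * η * ρ ^ 2 := by gcongr
  have q2 : B * S * η * ρ ≤ B * S * η * ρ ^ 2 := by gcongr
  have q3 : B * 1 * η * ρ ^ 2 ≤ B * S * η * ρ ^ 2 := by gcongr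
  linarith

lemma pointLoss_eq_residual_sq (uNext u : (Fin d → ℝ) → ℝ) (z : (Fin d → ℝ) → Fin d → ℝ)
    (w : Sample d) : pointLoss e P D G i uNext u z w = residual e P D G i uNext u z w ^ 2 := rfl

lemma pointLoss_le (hS : NetBounds d H S) (hd : 1 ≤ d) (hC : D.Cf * G.step i < 1)
    {uNext : (Fin d → ℝ) → ℝ} (hN : ∀ x, |uNext x| ≤ 2 * (1 + D.Cfg) * S ^ 2 * (norm1 x + 1))
    {θ : PairParams d H} (hθ : ‖θ‖ ≤ S) (w : Sample d) :
    pointLoss e P D G i uNext (netU θ.1) (netZ θ.2) w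
      ≤ residualBound P.T D.Cfg S ^ 2 * dominant P w ^ 4 := by
  have h := pow_le_pow_left₀ (abs_nonneg _)
    (abs_residual_le (e := e) (i := i) hS hd hC hN hθ w) 2
  rw [sq_abs] at h
  rw [pointLoss_eq_residual_sq]
  linarith [show (residualBound P.T D.Cfg S * dominant P w ^ 2) ^ 2
    = residualBound P.T D.Cfg S ^ 2 * dominant P w ^ 4 by ring]

lemma abs_pointLoss_sub_le (hS : NetBounds d H S) (hd : 1 ≤ d) (hC : D.Cf * G.step i < 1)
    {uNext : (Fin d → ℝ) → ℝ} (hN : ∀ x, |uNext x| ≤ 2 * (1 + D.Cfg) * S ^ 2 * (norm1 x + 1))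
    {θ θ' : PairParams d H} (hθ : ‖θ‖ ≤ S) (hθ' : ‖θ'‖ ≤ S) (w : Sample d) :
    |pointLoss e P D G i uNext (netU θ.1) (netZ θ.2) w
        - pointLoss e P D G i uNext (netU θ'.1) (netZ θ'.2) w|
      ≤ ‖θ - θ'‖ * (16 * residualBound P.T D.Cfg S * (3 * S ^ 2) ^ depth H * S
        * dominant P w ^ 4) := by
  have h1 := abs_residual_le (e := e) (i := i) hS hd hC hN hθ w
  have h2 := abs_residual_le (e := e) (i := i) hS hd hC hN hθ' w
  have h3 := abs_residual_sub_le (e := e) (i := i) hS hd hC (uNext := uNext) (θ' := θ') hθ w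
  rw [pointLoss_eq_residual_sq, pointLoss_eq_residual_sq, sq_sub_sq, abs_mul]
  have h4 := abs_add_le (residual e P D G i uNext (netU θ.1) (netZ θ.2) w)
    (residual e P D G i uNext (netU θ'.1) (netZ θ'.2) w)
  calc _ ≤ (2 * (residualBound P.T D.Cfg S * dominant P w ^ 2))
        * (8 * (3 * S ^ 2) ^ depth H * S * ‖θ - θ'‖ * dominant P w ^ 2) := by
        refine mul_le_mul (by linarith) h3 (abs_nonneg _) ?_
        linarith [(abs_nonneg _).trans h1]
    _ = _ := by ring

/-! ### Measurability and integrability of the network losses -/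

lemma measurable_netU_comp {α : Type*} [MeasurableSpace α] {θ : α → PairParams d H}
    {x : α → Fin d → ℝ} (hθ : Measurable θ) (hx : Measurable x) :
    Measurable fun q => netU (θ q).1 (x q) :=
  (measurable_pi_apply 0).comp ((continuous_network d H 1).measurable.comp
    ((measurable_fst.comp hθ).prodMk hx))

lemma measurable_netZ_comp {α : Type*} [MeasurableSpace α] {θ : α → PairParams d H}
    {x : α → Fin d → ℝ} (hθ : Measurable θ) (hx : Measurable x) :
    Measurable fun q => netZ (θ q).2 (x q) :=
  (continuous_network d H d).measurable.comp ((measurable_snd.comp hθ).prodMk hx)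

lemma measurable_pointLoss {uNext : (Fin d → ℝ) → ℝ} (hN : Measurable uNext) :
    Measurable fun q : PairParams d H × Sample d =>
      pointLoss e P D G i uNext (netU q.1.1) (netZ q.1.2) q.2 := by
  have hX : Measurable fun q : PairParams d H × Sample d => state e P (G.time i) q.2 :=
    (measurable_state e P (G.time i)).comp measurable_snd
  have hX' : Measurable fun q : PairParams d H × Sample d =>
      nextState e P (G.time i) (G.step i) q.2 :=
    (measurable_nextState e P (G.time i) (G.step i)).comp measurable_snd
  have hI : Measurable fun q : PairParams d H × Sample d => increment (G.step i) q.2 :=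
    (measurable_increment (G.step i)).comp measurable_snd
  have hu := measurable_netU_comp measurable_fst hX
  have hz := measurable_netZ_comp measurable_fst hX
  have hf := (D.continuous_f (G.time_mem_Icc i)).measurable.comp (hX.prodMk (hu.prodMk hz))
  refine ((hN.comp hX').sub ((hu.sub (hf.mul_const _)).add (Finset.measurable_sum _ fun k _ =>
    ((measurable_pi_apply k).comp hz).mul ((measurable_pi_apply k).comp hI)))).pow_const 2

lemma pointLoss_nonneg (uNext u : (Fin d → ℝ) → ℝ) (z : (Fin d → ℝ) → Fin d → ℝ) (w : Sample d) :
    0 ≤ pointLoss e P D G i uNext u z w := sq_nonneg _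

lemma measurable_pointLoss_net {uNext : (Fin d → ℝ) → ℝ} (hN : Measurable uNext)
    (θ : PairParams d H) : Measurable (pointLoss e P D G i uNext (netU θ.1) (netZ θ.2)) := by
  have h : Measurable ((fun q : PairParams d H × Sample d =>
      pointLoss e P D G i uNext (netU q.1.1) (netZ q.1.2) q.2) ∘ Prod.mk θ) :=
    (measurable_pointLoss hN).comp measurable_prodMk_left
  exact h
-- Joint measurability in parameter and sample makes the risk measurable in the parameter, so it can
-- be evaluated at a random one.
lemma measurable_risk {uNext : (Fin d → ℝ) → ℝ} (hN : Measurable uNext) :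
    Measurable fun θ : PairParams d H => risk e P D G i uNext θ :=
  ((measurable_pointLoss (e := e) (P := P) (D := D) (G := G) (i := i)
    hN).stronglyMeasurable.integral_prod_right).measurable

lemma admissible_net (hS : NetBounds d H S) (hd : 1 ≤ d) {θ : PairParams d H} (hθ : ‖θ‖ ≤ S) :
    Admissible e P G i (netU θ.1) (netZ θ.2) := by
  have hX := measurable_state e P (d := d) (G.time i)
  have hu : Measurable (netU θ.1 : (Fin d → ℝ) → ℝ) :=
    measurable_netU_comp (θ := fun _ => θ) measurable_const measurable_id
  have hz : Measurable (netZ θ.2 : (Fin d → ℝ) → Fin d → ℝ) :=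
    measurable_netZ_comp (θ := fun _ => θ) measurable_const measurable_id
  refine admissible_iff.2 ⟨hu, hz, ?_, ?_⟩
  · refine MemLp.mono ((memLp_dominant P hd).const_mul (4 * S ^ 2))
      (hu.comp hX).aestronglyMeasurable (ae_of_all _ fun w => ?_)
    exact (abs_netU_state_le hS hd ((norm_fst_le θ).trans hθ) w).trans (le_abs_self _)
  · refine MemLp.mono ((memLp_dominant P hd).const_mul (4 * S ^ 3))
      (continuous_norm2.measurable.comp (hz.comp hX)).aestronglyMeasurable
      (ae_of_all _ fun w => ?_)
    rw [Real.norm_of_nonneg (norm2_nonneg _)]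
    exact (norm2_netZ_state_le hS hd ((norm_snd_le θ).trans hθ) w).trans (le_abs_self _)

lemma memLp_uNext (hd : 1 ≤ d) {uNext : (Fin d → ℝ) → ℝ} (hNm : Measurable uNext) {C : ℝ}
    (hC0 : 0 ≤ C) (hN : ∀ x, |uNext x| ≤ C * (norm1 x + 1)) :
    MemLp (fun w => uNext (nextState e P (G.time i) (G.step i) w)) 2 (sampleLaw d) :=
  MemLp.mono ((memLp_dominant P hd).const_mul (2 * C))
    (hNm.comp (measurable_nextState e P (G.time i) (G.step i))).aestronglyMeasurable
    (ae_of_all _ fun w => (abs_uNext_le hd hC0 hN w).trans (le_abs_self _))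

/-- The function passed to the current step is measurable and grows at most linearly. -/
lemma IsNextStage.growth {p : MvPolynomial (Fin 2) ℝ} {ε : ℝ} {uNext : (Fin d → ℝ) → ℝ}
    (h : IsNextStage P D G i p ε uNext) (hS : S = MvPolynomial.eval ![(d : ℝ), ε⁻¹] p)
    (hS1 : 1 ≤ S) :
    Measurable uNext ∧ ∀ x, |uNext x| ≤ 2 * (1 + D.Cfg) * S ^ 2 * (norm1 x + 1) := by
  have hCfg := D.Cfg_nonneg
  have hS2 : 1 ≤ S ^ 2 := one_le_pow₀ hS1
  -- In the last step the next value is g, with growth constant 1 + C_{fg}; otherwise it is a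
  -- network with constant 2S². The stated constant covers both.
  rcases (Nat.succ_le_of_lt i.isLt).eq_or_lt with hi | hi
  · rw [h.1 hi]
    refine ⟨D.continuous_g.measurable, fun x => ?_⟩
    have h1 := D.g_lip x 0
    have h2 := abs_sub_abs_le_abs_sub (D.g x) (D.g 0)
    rw [sub_zero] at h1
    have h3 : D.Cg * norm2 x ≤ (1 + D.Cfg) * norm1 x := by
      have := norm2_le_norm1 x
      have := D.Cg_le
      have := norm2_nonneg x
      gcongr
    have h4 := D.abs_g_zero_le
    have hn := norm1_nonneg x
    calc |D.g x| ≤ 1 * (1 + D.Cfg) * 1 * (norm1 x + 1) := by linarith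
      _ ≤ _ := by gcongr; norm_num
  · obtain ⟨H', R', hsize, ϑ, hϑ, rfl⟩ := h.2 hi
    rw [← hS] at hsize
    obtain ⟨hR, -, -, hs, -⟩ := sizesLe_of_netSize_le hsize
    -- The second component 0 is a dummy: the measurability lemma is stated for pairs of networks.
    refine ⟨measurable_netU_comp (θ := fun _ => (ϑ, 0)) measurable_const measurable_id,
      fun x => ?_⟩
    have hn := norm1_nonneg x
    calc |netU ϑ x| ≤ 2 * S ^ 2 * (norm1 x + 1) := abs_network_le hS1 hs (hϑ.trans hR) x 0
      _ = 2 * 1 * S ^ 2 * (norm1 x + 1) := by ring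
      _ ≤ _ := by gcongr; linarith

end Pathwise

/-! ### The excess risk bound -/

/-- The truncation level of the integrand. -/
noncomputable def truncationLevel (M V q : ℝ) : ℝ := 8 * M ^ 4 * V * q

/-- The bound of the logarithm of the covering number. -/
noncomputable def entropyBound (S M V q : ℝ) : ℝ :=
  4 * S ^ 3 * (3 * S ^ 3 + 512 * S ^ 2 * M * V * q + 3)

/-- The mesh is inversely proportional to (3S²)^k, exponential in the depth. Since k ≤ S, the
logarithm of this factor is at most 3S³, and n ≤ 4S³ parameters leave a polynomial. The factor is at
least 1, which lets it absorb the summand 3. -/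
lemma log_net_card_le {S M V q R : ℝ} {k n : ℕ} (hS : 1 ≤ S) (hM : 1 ≤ M) (hV : 1 ≤ V)
    (hq : 0 < q) (hR0 : 0 ≤ R) (hR : R ≤ S) (hk : (k : ℝ) ≤ S) (hn : (n : ℝ) ≤ 4 * S ^ 3) {c : ℕ}
    (hc0 : 0 < c) (hc : (c : ℝ) ≤
      (2 * R / (256 * M * (3 * S ^ 2) ^ k * S * V * q)⁻¹ + 3) ^ n) :
    Real.log c ≤ entropyBound S M V q := by
  set B := (3 * S ^ 2) ^ k with hB
  have hS2 : 1 ≤ 3 * S ^ 2 := by nlinarith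
  have hB1 : 1 ≤ B := one_le_pow₀ hS2
  have hc0' : (0 : ℝ) < c := by exact_mod_cast hc0
  have h1 : 2 * R / (256 * M * B * S * V * q)⁻¹ + 3 ≤ B * (512 * S ^ 2 * M * V * q + 3) := by
    rw [div_inv_eq_mul]
    have : 2 * R * (256 * M * B * S * V * q) ≤ 2 * S * (256 * M * B * S * V * q) := by
      gcongr
    nlinarith
  have h0 : 0 < 2 * R / (256 * M * B * S * V * q)⁻¹ + 3 := by positivity
  have h2 : Real.log B ≤ 3 * S ^ 3 := by
    rw [hB, Real.log_pow]
    have h3 : Real.log (3 * S ^ 2) ≤ 3 * S ^ 2 := Real.log_le_self (by positivity)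
    calc (k : ℝ) * Real.log (3 * S ^ 2) ≤ S * (3 * S ^ 2) := by
          have := Real.log_nonneg hS2
          gcongr
      _ = _ := by ring
  have h4 : Real.log (2 * R / (256 * M * B * S * V * q)⁻¹ + 3)
      ≤ 3 * S ^ 3 + (512 * S ^ 2 * M * V * q + 3) := by
    refine (Real.log_le_log h0 h1).trans ?_
    rw [Real.log_mul (by positivity) (by positivity)]
    exact add_le_add h2 (Real.log_le_self (by positivity))
  refine (Real.log_le_log hc0' hc).trans ?_
  rw [Real.log_pow]
  have h5 : 0 ≤ 3 * S ^ 3 + (512 * S ^ 2 * M * V * q + 3) := by positivity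
  calc (n : ℝ) * Real.log (2 * R / (256 * M * B * S * V * q)⁻¹ + 3)
      ≤ n * (3 * S ^ 3 + (512 * S ^ 2 * M * V * q + 3)) := by gcongr
    _ ≤ 4 * S ^ 3 * (3 * S ^ 3 + (512 * S ^ 2 * M * V * q + 3)) := by gcongr
    _ = _ := by
      unfold entropyBound
      ring

lemma card_paramIdx_pair_le {d : ℕ} {H : List ℕ} {S : ℝ} (hS : NetBounds d H S) :
    ((Fintype.card (ParamIdx d H 1) + Fintype.card (ParamIdx d H d) : ℕ) : ℝ) ≤ 4 * S ^ 3 := by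
  have h1 := card_paramIdx_le d H 1 hS.sizes_U
  have h2 := card_paramIdx_le d H d hS.sizes_Z
  have hS1 := hS.one_le
  have h3 : (depth H : ℝ) * (S ^ 2 + S) ≤ S * (S ^ 2 + S ^ 2) := by
    have h4 : S ≤ S ^ 2 := by nlinarith
    have h5 := hS.depth_le
    gcongr
  push_cast
  nlinarith

theorem excess_risk_le {e : EquationType} {P : ModelParams} {d : ℕ} (hd : 1 ≤ d)
    {D : PDEData P.T d} {G : TimeGrid P.T} {i : Fin G.N} (hC : D.Cf * G.step i < 1)
    {H : List ℕ} {R S : ℝ} (hS : NetBounds d H S) (hRS : R ≤ S) {uNext uo : (Fin d → ℝ) → ℝ}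
    {zo : (Fin d → ℝ) → Fin d → ℝ} (hNm : Measurable uNext)
    (hN : ∀ x, |uNext x| ≤ 2 * (1 + D.Cfg) * S ^ 2 * (norm1 x + 1))
    (hopt : IsOptimalPair e P D G i uNext uo zo) {δ : ℝ} (hδ : 0 < δ) {θ₀ : PairParams d H}
    (hθ₀ : θ₀ ∈ paramSet d H R)
    (happrox : approxError e P G i uo (netU θ₀.1) zo (netZ θ₀.2) ≤ δ / (6 * (5 + P.T * d)))
    {V : ℝ} (hV1 : 1 ≤ V)
    (hV : ∫ w : Sample d, dominant P w ^ 8 ∂(sampleLaw d) ≤ V) {m : ℕ} (hm0 : 0 < m)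
    (hm : 8 * entropyBound S (residualBound P.T D.Cfg S) V δ⁻¹
      * truncationLevel (residualBound P.T D.Cfg S) V δ⁻¹ ^ 2 * δ⁻¹ ^ 2 ≤ m)
    {Ω : Type*} [MeasurableSpace Ω] {μ₀ : Measure Ω} [IsProbabilityMeasure μ₀]
    {w : Fin m → Ω → Sample d} {θ : Ω → PairParams d H} (hw : ∀ j, Measurable (w j))
    (hlaw : ∀ j, μ₀.map (w j) = sampleLaw d) (hind : iIndepFun w μ₀) (hθ : Measurable θ)
    (hmin : ∀ ω, θ ω ∈ paramSet d H R ∧ ∀ θ' ∈ paramSet d H R,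
      empiricalRisk e P D G i uNext (fun j => w j ω) (θ ω)
        ≤ empiricalRisk e P D G i uNext (fun j => w j ω) θ') :
    Integrable (fun ω => risk e P D G i uNext (θ ω)) μ₀ ∧
      ∫ ω, (risk e P D G i uNext (θ ω) - loss e P D G i uNext uo zo) ∂μ₀ ≤ δ := by
  set M := residualBound P.T D.Cfg S with hMdef
  set K := truncationLevel M V δ⁻¹ with hKdef
  set Γ := entropyBound S M V δ⁻¹ with hΓdef
  set B := (3 * S ^ 2) ^ depth H with hBdef
  have hS1 := hS.one_le
  have hM1 : 1 ≤ M := one_le_residualBound P.T_pos.le D.Cfg_nonneg hS1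
  have hδi : 0 < δ⁻¹ := inv_pos.2 hδ
  have hB0 : 0 < B := by positivity
  have hK0 : 0 < K := by
    rw [hKdef, truncationLevel]
    positivity
  have hΓ0 : 0 < Γ := by
    rw [hΓdef, entropyBound]
    positivity
  have hm0' : (0 : ℝ) < m := by exact_mod_cast hm0
  -- The net error is 2r · 16MBS E ρ⁴ ≤ 32 r MBSV, which is δ/8 for this mesh.
  set r := (256 * M * B * S * V * δ⁻¹)⁻¹ with hr
  have hr0 : 0 < r := by positivity
  have hR0 : 0 ≤ R := (norm_nonneg θ₀).trans hθ₀
  obtain ⟨N, hNR, hNnet, hNcard⟩ := exists_net_prod (ι := ParamIdx d H 1) (κ := ParamIdx d H d)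
    hR0 hr0
  have hNpos : 0 < N.card := by
    obtain ⟨c, hc, -⟩ := hNnet θ₀ hθ₀
    exact Finset.card_pos.2 ⟨c, hc⟩
  have hlog : Real.log N.card ≤ Γ := log_net_card_le hS1 hM1 hV1 hδi hR0 hRS hS.depth_le
    (card_paramIdx_pair_le hS) hNpos hNcard
  have hρ4 := integrable_dominant_pow P hd (n := 4) (by norm_num)
  have hρ8 := integrable_dominant_pow P hd (n := 8) le_rfl
  have hV4 : ∫ w : Sample d, dominant P w ^ 4 ∂(sampleLaw d) ≤ V :=
    (integral_mono hρ4 hρ8 fun w => pow_le_pow_right₀ (one_le_dominant P hd w)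
      (by norm_num)).trans hV
  have henv2 : (fun w : Sample d => (M ^ 2 * dominant P w ^ 4) ^ 2)
      = fun w => M ^ 4 * dominant P w ^ 8 := by
    funext w
    ring
  have hrisk_nonneg : ∀ θ' : PairParams d H, 0 ≤ risk e P D G i uNext θ' := fun θ' =>
    integral_nonneg fun w => pointLoss_nonneg _ _ _ _
  have hint : Integrable (fun ω => risk e P D G i uNext (θ ω)) μ₀ := by
    refine (integrable_const (M ^ 2 * V)).mono' ((measurable_risk hNm).comp hθ).aestronglyMeasurable
      (ae_of_all _ fun ω => ?_)
    rw [Real.norm_of_nonneg (hrisk_nonneg _)]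
    refine (integral_mono_of_nonneg (ae_of_all _ fun w => pointLoss_nonneg _ _ _ _) (hρ4.const_mul (M ^ 2))
      (ae_of_all _ fun w => pointLoss_le hS hd hC hN ((hmin ω).1.trans hRS) w)).trans ?_
    rw [integral_const_mul]
    gcongr
  refine ⟨hint, ?_⟩
  have hg0 : ∀ (θ' : PairParams d H) w,
      0 ≤ pointLoss e P D G i uNext (netU θ'.1) (netZ θ'.2) w := fun _ _ => pointLoss_nonneg _ _ _ _
  have hgm : ∀ θ' : PairParams d H,
      Measurable (pointLoss e P D G i uNext (netU θ'.1) (netZ θ'.2)) := 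
    measurable_pointLoss_net hNm
  have henv : ∀ θ' ∈ paramSet d H R, ∀ w,
      pointLoss e P D G i uNext (netU θ'.1) (netZ θ'.2) w ≤ M ^ 2 * dominant P w ^ 4 :=
    fun θ' hθ' w => pointLoss_le hS hd hC hN (le_trans hθ' hRS) w
  have henv2i : Integrable (fun w : Sample d => (M ^ 2 * dominant P w ^ 4) ^ 2) (sampleLaw d) := by
    rw [henv2]
    exact hρ8.const_mul _
  have hnet : ∀ θ' ∈ paramSet d H R, ∃ c ∈ N, ∀ w : Sample d,
      |pointLoss e P D G i uNext (netU θ'.1) (netZ θ'.2) w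
        - pointLoss e P D G i uNext (netU c.1) (netZ c.2) w|
        ≤ r * (16 * M * B * S * dominant P w ^ 4) := by
    intro θ' hθ'
    obtain ⟨c, hc, hθc⟩ := hNnet θ' hθ'
    refine ⟨c, hc, fun w => (abs_pointLoss_sub_le hS hd hC hN (le_trans hθ' hRS)
      ((hNR c hc).trans hRS) w).trans ?_⟩
    have := one_le_dominant P hd w
    exact mul_le_mul_of_nonneg_right hθc (by positivity)
  have hmin' := fun ω => (hmin ω).2 θ₀ hθ₀
  unfold empiricalRisk at hmin'
  have hrisk : ∀ θ' : PairParams d H, risk e P D G i uNext θ'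
      = ∫ w, pointLoss e P D G i uNext (netU θ'.1) (netZ θ'.2) w ∂(sampleLaw d) := fun _ => rfl
  have hint' := hint
  simp_rw [hrisk] at hint'
  -- The choice λ = 8Γ/δ makes the entropy term at most δ/8, and the lower bound on m does the same
  -- for λK²/(8m). With truncation and net error this gives four terms of size δ/8; the
  -- approximation error takes the other δ/2.
  have hmain := integral_risk_minimizer_le (Θ := PairParams d H) hm0 hw hlaw hind
    hg0 hgm henv (hρ4.const_mul _) henv2i (hρ4.const_mul _) hnet hK0
    (lam := 8 * Γ * δ⁻¹) (by positivity) hθ₀ (fun ω => (hmin ω).1) hmin' hint'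
  rw [henv2, integral_const_mul, integral_const_mul] at hmain
  have hbias := (loss_sub_loss_optimal_le (D := D) (G := G) (i := i) hd hC
    (memLp_uNext hd hNm (by have := D.Cfg_nonneg; positivity) hN) hopt
    (admissible_net hS hd (le_trans hθ₀ hRS)))
  have hTd : 0 < 5 + P.T * d := by
    have := P.T_pos
    positivity
  have t1 : 3 * (5 + P.T * d) * approxError e P G i uo (netU θ₀.1) zo (netZ θ₀.2) ≤ δ / 2 := by
    calc _ ≤ 3 * (5 + P.T * d) * (δ / (6 * (5 + P.T * d))) := by gcongr
      _ = δ / 2 := by field_simp; norm_num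
  have t2 : M ^ 4 * (∫ w : Sample d, dominant P w ^ 8 ∂(sampleLaw d)) / K ≤ δ / 8 := by
    calc _ ≤ M ^ 4 * V / K := by gcongr
      _ = δ / 8 := by
        rw [hKdef, truncationLevel]
        field_simp
  have t3 : 2 * r * (16 * M * B * S * ∫ w : Sample d, dominant P w ^ 4 ∂(sampleLaw d))
      ≤ δ / 8 := by
    calc _ ≤ 2 * r * (16 * M * B * S * V) := by gcongr
      _ = δ / 8 := by
        rw [hr]
        field_simp
        norm_num
  have t4 : Real.log N.card / (8 * Γ * δ⁻¹) ≤ δ / 8 := by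
    calc _ ≤ Γ / (8 * Γ * δ⁻¹) := by gcongr
      _ = δ / 8 := by field_simp
  have t5 : 8 * Γ * δ⁻¹ * K ^ 2 / (8 * m) ≤ δ / 8 := by
    rw [div_le_iff₀ (by positivity)]
    calc 8 * Γ * δ⁻¹ * K ^ 2 = δ * (8 * Γ * K ^ 2 * δ⁻¹ ^ 2) := by field_simp
      _ ≤ δ * m := by gcongr
      _ = _ := by ring
  rw [integral_sub hint (integrable_const _)]
  simp only [integral_const, probReal_univ, one_smul]
  simp_rw [← hrisk] at hmain
  have hloss : loss e P D G i uNext (netU θ₀.1) (netZ θ₀.2) = risk e P D G i uNext θ₀ := rfl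
  rw [hloss] at hbias
  linarith

/-- The sample size bound is a polynomial in `δ⁻¹`, the dimension and `C_{fg}`. -/
lemma exists_sampleSize_polynomial (T C : ℝ) (p : MvPolynomial (Fin 2) ℝ) :
    ∃ h : MvPolynomial (Fin 3) ℝ, ∀ x y c S : ℝ,
      S = MvPolynomial.eval ![y, 6 * (5 + T * y) * x] p →
      MvPolynomial.eval ![x, y, c] h = S + 8 * entropyBound S (residualBound T c S) (C * y ^ 8) x
        * truncationLevel (residualBound T c S) (C * y ^ 8) x ^ 2 * x ^ 2 := by
  let κ : ℝ → MvPolynomial (Fin 3) ℝ := fun r => MvPolynomial.C r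
  let x : MvPolynomial (Fin 3) ℝ := MvPolynomial.X 0
  let y : MvPolynomial (Fin 3) ℝ := MvPolynomial.X 1
  -- The second variable of `p` is replaced by ε⁻¹ = 6(5 + Td) δ⁻¹, which is polynomial in d and
  -- δ⁻¹.
  let S : MvPolynomial (Fin 3) ℝ :=
    MvPolynomial.bind₁ ![y, κ 6 * (κ 5 + κ T * y) * x] p
  let M : MvPolynomial (Fin 3) ℝ := κ 25 * ((κ 1 + κ T) * (κ 1 + MvPolynomial.X 2)) * S ^ 3
  let V : MvPolynomial (Fin 3) ℝ := κ C * y ^ 8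
  -- The leading summand S lets one polynomial bound the network size as well as the sample size.
  refine ⟨S + κ 8 * (κ 4 * S ^ 3 * (κ 3 * S ^ 3 + κ 512 * S ^ 2 * M * V * x + κ 3))
    * (κ 8 * M ^ 4 * V * x) ^ 2 * x ^ 2, ?_⟩
  intro x' y' c s hs
  have hS : MvPolynomial.eval ![x', y', c] S = s := by
    rw [hs]
    simp only [S, MvPolynomial.eval, MvPolynomial.eval₂Hom_bind₁]
    congr 2
    funext j
    fin_cases j <;> simp [x, y, κ]
  have hM : MvPolynomial.eval ![x', y', c] M = residualBound T c s := by
    simp only [M, map_mul, map_add, map_pow, hS, residualBound]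
    simp [κ]
  simp only [map_mul, map_add, map_pow, hS, hM, entropyBound, truncationLevel, V]
  simp [κ, x, y]

end DBDP

theorem theorem4p3 (P : DBDP.ModelParams) (p : MvPolynomial (Fin 2) ℝ) :
    ∃ h : MvPolynomial (Fin 3) ℝ,
      ∀ (e : DBDP.EquationType) (d : ℕ), 1 ≤ d →
      ∀ (D : DBDP.PDEData P.T d) (G : DBDP.TimeGrid P.T) (i : Fin G.N),
      D.Cf * G.step i < 1 →
      ∀ (H : ℝ → List ℕ) (R : ℝ → ℝ) (uNext uOpt : ℝ → (Fin d → ℝ) → ℝ)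
        (zOpt : ℝ → (Fin d → ℝ) → Fin d → ℝ),
      DBDP.ApproxAssumption e P D G i p H R uNext uOpt zOpt →
      ∀ δ : ℝ, 0 < δ → ∃ ε : ℝ, 0 < ε ∧
        DBDP.netSize d (H ε) (R ε) ≤ MvPolynomial.eval ![δ⁻¹, (d : ℝ), D.Cfg] h ∧
        ∀ m : ℕ, MvPolynomial.eval ![δ⁻¹, (d : ℝ), D.Cfg] h ≤ (m : ℝ) →
        ∀ (Ω : Type*) [MeasurableSpace Ω] (μ₀ : Measure Ω) [IsProbabilityMeasure μ₀]
          (w : Fin m → Ω → DBDP.Sample d) (θ : Ω → DBDP.PairParams d (H ε)),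
        (∀ j, Measurable (w j)) →
        (∀ j, μ₀.map (w j) = DBDP.sampleLaw d) →
        iIndepFun w μ₀ →
        Measurable θ →
        (∀ ω, θ ω ∈ DBDP.paramSet d (H ε) (R ε) ∧
          ∀ θ' ∈ DBDP.paramSet d (H ε) (R ε),
            DBDP.empiricalRisk e P D G i (uNext ε) (fun j => w j ω) (θ ω) ≤
              DBDP.empiricalRisk e P D G i (uNext ε) (fun j => w j ω) θ') →
        Integrable (fun ω => DBDP.risk e P D G i (uNext ε) (θ ω)) μ₀ ∧
        ∫ ω, (DBDP.risk e P D G i (uNext ε) (θ ω) -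
          DBDP.loss e P D G i (uNext ε) (uOpt ε) (zOpt ε)) ∂μ₀ ≤ δ := by
  obtain ⟨C, hC1, hmoment⟩ := DBDP.exists_dominant_moment_bound P
  obtain ⟨h, hh⟩ := DBDP.exists_sampleSize_polynomial P.T C p
  refine ⟨h, fun e d hd D G i hCf H R uNext uOpt zOpt hA δ hδ => ?_⟩
  have hT := P.T_pos
  have hd' : (1 : ℝ) ≤ d := by exact_mod_cast hd
  have hTd : 0 < 6 * (5 + P.T * d) := by positivity
  have hε : 0 < δ / (6 * (5 + P.T * d)) := by positivity
  -- At this level the approximation error, multiplied by 3(5 + Td), is at most δ/2.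
  refine ⟨δ / (6 * (5 + P.T * d)), hε, ?_⟩
  obtain ⟨hnext, hopt, hsize, θ₀, hθ₀, happrox⟩ := hA _ hε
  set ε := δ / (6 * (5 + P.T * d)) with hεdef
  set S := MvPolynomial.eval ![(d : ℝ), ε⁻¹] p with hSdef
  have hεi : ε⁻¹ = 6 * (5 + P.T * d) * δ⁻¹ := by rw [hεdef, inv_div, div_eq_mul_inv]
  rw [hh δ⁻¹ d D.Cfg S (by rw [hSdef, hεi])]
  obtain ⟨hRS, hdepth, hS1, hsU, hsZ⟩ := DBDP.sizesLe_of_netSize_le hsize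
  obtain ⟨hNm, hN⟩ := hnext.growth hSdef hS1
  have hV1 : 1 ≤ C * (d : ℝ) ^ 8 := one_le_mul_of_one_le_of_one_le hC1 (one_le_pow₀ hd')
  have hM1 := DBDP.one_le_residualBound hT.le D.Cfg_nonneg hS1
  have hδi : 0 < δ⁻¹ := inv_pos.2 hδ
  have hrest : 0 ≤ 8 * DBDP.entropyBound S (DBDP.residualBound P.T D.Cfg S) (C * d ^ 8) δ⁻¹
      * DBDP.truncationLevel (DBDP.residualBound P.T D.Cfg S) (C * d ^ 8) δ⁻¹ ^ 2
      * δ⁻¹ ^ 2 := by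
    unfold DBDP.entropyBound
    positivity
  refine ⟨by linarith, fun m hm Ω _ μ₀ _ w θ hw hlaw hind hθ hmin => ?_⟩
  -- The summand S ≥ 1 of the polynomial excludes an empty sample.
  have hm0 : 0 < m := by
    have : (0 : ℝ) < m := by linarith
    exact_mod_cast this
  exact DBDP.excess_risk_le hd hCf ⟨hS1, hdepth, hsU, hsZ⟩ hRS hNm hN hopt hδ hθ₀ happrox hV1
    (hmoment d hd).2 hm0 (by linarith) hw hlaw hind hθ hmin
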